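/- Throughout, $z^k:=|z|^k e^{ik\arg z}$ with $\arg z\in\left]-\pi,\pi\right]$, $\mathcal H$ is the upper half-plane, $T:=\begin{pmatrix}1&1\\0&1\end{pmatrix}$, and $j(\gamma,\tau):=c\tau+d$ for $\gamma=\begin{pmatrix}a&b\\c&d\end{pmatrix}$. Let $p\in\mathbb Z_{>0}$, $k\in\mathbb R$, and let $v:\mathrm{SL}_2(\mathbb Z)\to\{z\in\mathbb C:|z|=1\}$ be a unitary multiplier system of weight $k$, i.e., $\mu(\gamma,\tau):=v(\gamma)j(\gamma,\tau)^k$ satisfies $\mu(\gamma_1\gamma_2,\tau)=\mu(\gamma_1,\gamma_2.\tau)\mu(\gamma_2,\tau)$ for all $\gamma_1,\gamma_2\in\mathrm{SL}_2(\mathbb Z)$ and $\tau\in\mathcal H$. Assume that $v(-I_2)=(-1)^{-k}$, and let $\kappa\in[0,1[$ be given by $v(T)=e^{2\pi i\kappa}$. For a function $F$ on $\mathcal H$ with values in $\mathbb C$ or $\mathbb C^p$ and $\gamma\in\mathrm{SL}_2(\mathbb Z)$, put $(F|_k\gamma)(\tau):=v(\gamma)^{-1}j(\gamma,\tau)^{-k}F(\gamma.\tau)$.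 Let $\Gamma\ni-I_2$ be a subgroup of finite index in $\mathrm{SL}_2(\mathbb Z)$, and let $\rho:\Gamma\to\mathrm{GL}_p(\mathbb C)$ be a unitary representation that is normal, i.e., $\rho(-I_2)=I_p$ and for all $\sigma\in\mathrm{SL}_2(\mathbb Z)$ and $M'\in\mathbb Z_{>0}$ with $\sigma T^{M'}\sigma^{-1}\in\Gamma$ there is $N\in\mathbb Z_{>0}$ such that $\left(e^{2\pi i\kappa M'}\rho(\sigma T^{M'}\sigma^{-1})\right)^N=I_p$. Let $\mathcal S(k,\rho,\Gamma)$ be the space of cuspidal vector-valued modular forms: all holomorphic $F=(F_1,\dots,F_p):\mathcal H\to\mathbb C^p$ such that $F|_k\gamma=\rho(\gamma)F$ for all $\gamma\in\Gamma$ and such that, for every $\sigma\in\mathrm{SL}_2(\mathbb Z)$ and every $i\in\{1,\dots,p\}$, the function $F_i|_k\sigma$ has an expansion $\sum_{n=h}^\infty a_n e^{2\pi i\frac nN\tau}$ on $\mathcal H$ with some $h,N\in\mathbb Z_{>0}$ and $a_n\in\mathbb C$ (depending on $i$ and $\sigma$). Let $M\in\mathbb Z_{>0}$ be such that the stabilizer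 of $\infty$ in $\Gamma$ is $\Gamma_\infty=\langle\pm T^M\rangle$, and let $U\in\mathrm U(p)$ and $m_1,\dots,m_p\in\left]0,1\right]\cap\mathbb Q$ be such that $$\rho(T^M)=e^{-2\pi i\kappa M}\,U^{-1}\,\mathrm{diag}(e^{2\pi im_1},\dots,e^{2\pi im_p})\,U.$$ For $\nu\in\mathbb Z_{\ge0}$ and $j\in\{1,\dots,p\}$, with $e_j$ the $j$th vector of the canonical basis of $\mathbb C^p$, define the classical Poincaré series $$\Psi_{k,\rho,\Gamma,\nu,U,j}:=\sum_{\gamma\in\Gamma_\infty\backslash\Gamma}\rho(\gamma)^{-1}\,f_{\nu,j}|_k\gamma,\qquad f_{\nu,j}(\tau):=e^{2\pi i\frac{\nu+m_j}M\tau}\,U^{-1}e_j.$$ **Corollary.** If $k>2$, then these series converge absolutely at every point of $\mathcal H$, and $$\mathcal S(k,\rho,\Gamma)=\mathrm{span}_{\mathbb C}\left\{\Psi_{k,\rho,\Gamma,\nu,U,j}:\nu\in\mathbb Z_{\ge0},\ j\in\{1,\dots,p\}\right\}.$$ -/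

import Mathlib

open UpperHalfPlane ModularGroup Matrix
open scoped MatrixGroups Manifold

noncomputable section

namespace VVMF

/-- The factor `j(γ, τ) = cτ + d` for `γ = (a b; c d)`. -/
def jFactor (γ : SL(2, ℤ)) (τ : ℍ) : ℂ :=
  ((γ 1 0 : ℤ) : ℂ) * (τ : ℂ) + ((γ 1 1 : ℤ) : ℂ)

/-- `μ(γ, τ) = v(γ) j(γ, τ)^k`, with `z^k = |z|^k e^{i k arg z}`, `arg z ∈ (-π, π]`
(the principal branch, as in Mathlib's complex power). -/
def autFactor (k : ℝ) (v : SL(2, ℤ) → Circle) (γ : SL(2, ℤ)) (τ : ℍ) : ℂ :=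
  (v γ : ℂ) * jFactor γ τ ^ (k : ℂ)

/-- `v` is a unitary multiplier system for `SL₂(ℤ)` of weight `k`. -/
def IsMultiplierSystem (k : ℝ) (v : SL(2, ℤ) → Circle) : Prop :=
  ∀ (γ₁ γ₂ : SL(2, ℤ)) (τ : ℍ),
    autFactor k v (γ₁ * γ₂) τ = autFactor k v γ₁ (γ₂ • τ) * autFactor k v γ₂ τ

/-- `(F|_k γ)(τ) = v(γ)⁻¹ j(γ, τ)^{-k} F(γ.τ)`, for functions with values in a complex
vector space (used for `ℂ` and for `ℂ^p`). -/
def slash {E : Type*} [SMul ℂ E] (k : ℝ) (v : SL(2, ℤ) → Circle) (F : ℍ → E)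
    (γ : SL(2, ℤ)) : ℍ → E :=
  fun τ => ((v γ : ℂ)⁻¹ * jFactor γ τ ^ (-(k : ℂ))) • F (γ • τ)

/-- `g(τ) = ∑_{n ≥ h} a_n e^{2πi (n/N) τ}` on the upper half-plane, for some positive integer `N`
and some complex coefficients (the summation index is shifted to start at `0`). -/
def HasExpansionFrom (h : ℤ) (g : ℍ → ℂ) : Prop :=
  ∃ (N : ℕ) (a : ℕ → ℂ), 0 < N ∧ ∀ τ : ℍ,
    HasSum (fun n : ℕ =>
      a n * Complex.exp (2 * Real.pi * Complex.I * (((h : ℂ) + (n : ℂ)) / (N : ℂ)) * (τ : ℂ)))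
      (g τ)

/-- The space `𝓕(k)`. -/
def scalarForms (k : ℝ) (v : SL(2, ℤ) → Circle) : Set (ℍ → ℂ) :=
  {f | MDifferentiable 𝓘(ℂ) 𝓘(ℂ) f ∧
    ∀ σ : SL(2, ℤ), ∃ h : ℤ, HasExpansionFrom h (slash k v f σ)}

/-- The space `𝓢(k)`. -/
def scalarCuspForms (k : ℝ) (v : SL(2, ℤ) → Circle) : Set (ℍ → ℂ) :=
  {f | f ∈ scalarForms k v ∧
    ∀ σ : SL(2, ℤ), ∃ h : ℤ, 0 < h ∧ HasExpansionFrom h (slash k v f σ)}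

variable {p : ℕ}

/-- The space `𝓕(k, ρ, Γ)` of vector-valued modular forms. -/
def forms (k : ℝ) (v : SL(2, ℤ) → Circle) (Γ : Subgroup SL(2, ℤ)) (ρ : Γ →* GL (Fin p) ℂ) :
    Set (ℍ → Fin p → ℂ) :=
  {F | (∀ i, (fun τ => F τ i) ∈ scalarForms k v) ∧
    ∀ (γ : Γ) (τ : ℍ), slash k v F (γ : SL(2, ℤ)) τ = (ρ γ : Matrix (Fin p) (Fin p) ℂ) *ᵥ F τ}

/-- The space `𝓢(k, ρ, Γ)` of cuspidal vector-valued modular forms. -/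
def cuspForms (k : ℝ) (v : SL(2, ℤ) → Circle) (Γ : Subgroup SL(2, ℤ)) (ρ : Γ →* GL (Fin p) ℂ) :
    Set (ℍ → Fin p → ℂ) :=
  forms k v Γ ρ ∩ {F | ∀ i, (fun τ => F τ i) ∈ scalarCuspForms k v}

/-- `ρ` takes values in the unitary group `U(p)`. -/
def IsUnitaryRep {Γ : Subgroup SL(2, ℤ)} (ρ : Γ →* GL (Fin p) ℂ) : Prop :=
  ∀ γ : Γ, (ρ γ : Matrix (Fin p) (Fin p) ℂ) ∈ Matrix.unitaryGroup (Fin p) ℂ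

/-- Normal representations of a group `Γ ∋ -I₂`, where `v(T) = e^{2πiκ}`. -/
structure IsNormalRep (κ : ℝ) {Γ : Subgroup SL(2, ℤ)} (ρ : Γ →* GL (Fin p) ℂ)
    (hneg : (-1 : SL(2, ℤ)) ∈ Γ) : Prop where
  map_neg_one : ρ ⟨-1, hneg⟩ = 1
  finite_order : ∀ (σ : SL(2, ℤ)) (M : ℕ) (_ : 0 < M) (hσ : σ * T ^ M * σ⁻¹ ∈ Γ),
    ∃ N : ℕ, 0 < N ∧
      (Complex.exp (2 * Real.pi * Complex.I * (κ : ℂ) * (M : ℂ)) •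
        (ρ ⟨σ * T ^ M * σ⁻¹, hσ⟩ : Matrix (Fin p) (Fin p) ℂ)) ^ N = 1

/-- The stabilizer `Γ_∞` of the cusp `∞` in `Γ`, for the action by linear fractional
transformations. -/
def cuspStabilizer (Γ : Subgroup SL(2, ℤ)) : Subgroup SL(2, ℤ) :=
  Γ ⊓ (MulAction.stabilizer (GL (Fin 2) ℝ) (OnePoint.infty : OnePoint ℝ)).comap
    (Matrix.SpecialLinearGroup.mapGL ℝ)

theorem T_pow_mem {Γ : Subgroup SL(2, ℤ)} {M : ℕ}
    (hM : cuspStabilizer Γ = Subgroup.closure {T ^ M, -T ^ M}) : T ^ M ∈ Γ := by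
  have h : T ^ M ∈ cuspStabilizer Γ := by
    rw [hM]
    exact Subgroup.subset_closure (by simp)
  exact h.1

/-- The action `F|_{k,ρ} γ = ρ(γ)⁻¹ F|_k γ` of `Γ`. -/
def slashRep (k : ℝ) (v : SL(2, ℤ) → Circle) {Γ : Subgroup SL(2, ℤ)} (ρ : Γ →* GL (Fin p) ℂ)
    (F : ℍ → Fin p → ℂ) (γ : Γ) : ℍ → Fin p → ℂ :=
  fun τ => ((ρ γ)⁻¹ : GL (Fin p) ℂ).1 *ᵥ slash k v F (γ : SL(2, ℤ)) τ

/-- The index set `Λ\Γ` of cosets `Λγ`, `γ ∈ Γ`. -/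
abbrev RightCosets {Γ : Subgroup SL(2, ℤ)} (Λ : Subgroup Γ) : Type :=
  Quotient (QuotientGroup.rightRel Λ)

/-- The Poincaré series `∑_{γ ∈ Λ\Γ} f|_{k,ρ} γ`, for `f` invariant under `|_{k,ρ} λ`, `λ ∈ Λ`.
The terms do not depend on the chosen representatives, see `slashRep_eq_of_rightRel`
(and `seed_invariant` for the invariance of the functions used below). -/
def poincareSeries (k : ℝ) (v : SL(2, ℤ) → Circle) {Γ : Subgroup SL(2, ℤ)}
    (ρ : Γ →* GL (Fin p) ℂ) (Λ : Subgroup Γ) (f : ℍ → Fin p → ℂ) : ℍ → Fin p → ℂ :=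
  fun τ => ∑' q : RightCosets Λ, slashRep k v ρ f q.out τ

/-- The function `τ ↦ e^{2πi ((ν + m_j)/M) τ} U⁻¹ e_j`. -/
def seed (M : ℕ) (U : Matrix.unitaryGroup (Fin p) ℂ) (m : Fin p → ℚ) (ν : ℕ) (j : Fin p) :
    ℍ → Fin p → ℂ :=
  fun τ => Complex.exp (2 * Real.pi * Complex.I * (((ν : ℂ) + (m j : ℂ)) / (M : ℂ)) * (τ : ℂ)) •
    ((U⁻¹ : Matrix.unitaryGroup (Fin p) ℂ) : Matrix (Fin p) (Fin p) ℂ) *ᵥ Pi.single j 1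

/-- The classical vector-valued Poincaré series `Ψ_{k,ρ,Γ,ν,U,j}`. -/
def classicalPoincare (k : ℝ) (v : SL(2, ℤ) → Circle) (Γ : Subgroup SL(2, ℤ))
    (ρ : Γ →* GL (Fin p) ℂ) (M : ℕ) (U : Matrix.unitaryGroup (Fin p) ℂ) (m : Fin p → ℚ)
    (ν : ℕ) (j : Fin p) : ℍ → Fin p → ℂ :=
  poincareSeries k v ρ ((cuspStabilizer Γ).subgroupOf Γ) (seed M U m ν j)

/-! Independence of the terms of the Poincaré series from the choice of representatives. -/

theorem slash_mul {E : Type*} [AddCommGroup E] [Module ℂ E] {k : ℝ} {v : SL(2, ℤ) → Circle}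
    (hv : IsMultiplierSystem k v) (F : ℍ → E) (γ₁ γ₂ : SL(2, ℤ)) :
    slash k v F (γ₁ * γ₂) = slash k v (slash k v F γ₁) γ₂ := by
  have key : ∀ γ τ, (v γ : ℂ)⁻¹ * jFactor γ τ ^ (-(k : ℂ)) = (autFactor k v γ τ)⁻¹ := by
    intro γ τ
    rw [autFactor, mul_inv, Complex.cpow_neg]
  funext τ
  simp only [slash, key, smul_smul, hv γ₁ γ₂ τ, mul_inv]
  rw [SemigroupAction.mul_smul γ₁ γ₂ τ, mul_comm]

theorem slashRep_mul {k : ℝ} {v : SL(2, ℤ) → Circle} (hv : IsMultiplierSystem k v)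
    {Γ : Subgroup SL(2, ℤ)} (ρ : Γ →* GL (Fin p) ℂ) (F : ℍ → Fin p → ℂ) (γ₁ γ₂ : Γ) :
    slashRep k v ρ F (γ₁ * γ₂) = slashRep k v ρ (slashRep k v ρ F γ₁) γ₂ := by
  funext τ
  simp only [slashRep, map_mul, _root_.mul_inv_rev, Subgroup.coe_mul, slash_mul hv,
    Units.val_mul]
  rw [← Matrix.mulVec_mulVec]
  congr 1
  simp [slash, slashRep, Matrix.mulVec_smul]

theorem slashRep_eq_of_rightRel {k : ℝ} {v : SL(2, ℤ) → Circle} (hv : IsMultiplierSystem k v)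
    {Γ : Subgroup SL(2, ℤ)} (ρ : Γ →* GL (Fin p) ℂ) (Λ : Subgroup Γ) (f : ℍ → Fin p → ℂ)
    (hf : ∀ l ∈ Λ, slashRep k v ρ f l = f) {γ₁ γ₂ : Γ}
    (h : QuotientGroup.rightRel Λ γ₁ γ₂) : slashRep k v ρ f γ₁ = slashRep k v ρ f γ₂ := by
  rw [QuotientGroup.rightRel_apply] at h
  have e : γ₂ = (γ₂ * γ₁⁻¹) * γ₁ := by group
  rw [e, slashRep_mul hv, hf _ h]

theorem slashRep_one {k : ℝ} {v : SL(2, ℤ) → Circle} (hv : IsMultiplierSystem k v)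
    {Γ : Subgroup SL(2, ℤ)} (ρ : Γ →* GL (Fin p) ℂ) (F : ℍ → Fin p → ℂ) :
    slashRep k v ρ F 1 = F := by
  have h := hv 1 1 UpperHalfPlane.I
  simp [autFactor, jFactor] at h
  funext τ
  simp [slashRep, slash, jFactor, h]

theorem seed_invariant {k : ℝ} {v : SL(2, ℤ) → Circle} (hv : IsMultiplierSystem k v)
    (hv_neg : (v (-1) : ℂ) = (-1 : ℂ) ^ (-(k : ℂ))) {κ : ℝ}
    (hκ : (v T : ℂ) = Complex.exp (2 * Real.pi * Complex.I * (κ : ℂ)))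
    {Γ : Subgroup SL(2, ℤ)} {hneg : (-1 : SL(2, ℤ)) ∈ Γ} {ρ : Γ →* GL (Fin p) ℂ}
    (hρn : IsNormalRep κ ρ hneg) {M : ℕ} (hM0 : 0 < M)
    (hM : cuspStabilizer Γ = Subgroup.closure {T ^ M, -T ^ M})
    {U : Matrix.unitaryGroup (Fin p) ℂ} {m : Fin p → ℚ}
    (hU : (ρ ⟨T ^ M, T_pow_mem hM⟩ : Matrix (Fin p) (Fin p) ℂ) =
      Complex.exp (-(2 * Real.pi * Complex.I * (κ : ℂ) * (M : ℂ))) •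
        (((U⁻¹ : Matrix.unitaryGroup (Fin p) ℂ) : Matrix (Fin p) (Fin p) ℂ) *
          Matrix.diagonal (fun j => Complex.exp (2 * Real.pi * Complex.I * (m j : ℂ))) *
          (U : Matrix (Fin p) (Fin p) ℂ))) (ν : ℕ) (j : Fin p) :
    ∀ l ∈ (cuspStabilizer Γ).subgroupOf Γ,
      slashRep k v ρ (seed M U m ν j) l = seed M U m ν j := by
  set f := seed M U m ν j with hf
  have hj : ∀ (n : ℕ) τ, jFactor (T ^ n) τ = 1 := by
    intro n τ
    have := ModularGroup.coe_T_zpow n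
    simp only [zpow_natCast] at this
    simp [jFactor, this]
  have hvT : ∀ n : ℕ, (v (T ^ n) : ℂ) = Complex.exp (2 * Real.pi * Complex.I * (κ : ℂ)) ^ n := by
    intro n
    induction n with
    | zero =>
      have h := hv 1 1 UpperHalfPlane.I
      simp [autFactor, jFactor] at h
      simp [h]
    | succ n ih =>
      have h := hv (T ^ n) T UpperHalfPlane.I
      rw [← pow_succ] at h
      have h1 := hj 1
      simp only [pow_one] at h1
      simp only [autFactor, hj, h1, Complex.one_cpow, mul_one, ih, hκ] at h
      rw [h, pow_succ]
  have hneg' : slashRep k v ρ f ⟨-1, hneg⟩ = f := by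
    funext τ
    have : jFactor (-1) τ = -1 := by simp [jFactor]
    have h2 : (-1 : ℂ) ^ (-(k : ℂ)) ≠ 0 := by simp [Complex.cpow_eq_zero_iff]
    simp [slashRep, slash, hρn.map_neg_one, this, hv_neg, h2]
  have hT : slashRep k v ρ f ⟨T ^ M, T_pow_mem hM⟩ = f := by
    funext τ
    have hτ : (((T ^ M • τ : ℍ)) : ℂ) = τ + M := by
      have := UpperHalfPlane.modular_T_zpow_smul τ M
      rw [zpow_natCast] at this
      rw [this]; simp [add_comm]
    have hinv : (ρ ⟨T ^ M, T_pow_mem hM⟩ : Matrix (Fin p) (Fin p) ℂ) *ᵥ f τ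
        = slash k v f (T ^ M) τ := by
      have hUU : (U : Matrix (Fin p) (Fin p) ℂ) * ((U⁻¹ : Matrix.unitaryGroup (Fin p) ℂ) : Matrix (Fin p) (Fin p) ℂ) = 1 := by
        rw [← Matrix.UnitaryGroup.mul_val]; simp
      have hM1 : (M : ℂ) ≠ 0 := by exact_mod_cast hM0.ne'
      rw [hU, slash, hf, seed, seed, hj, hvT, hτ]
      rw [Matrix.mulVec_smul, Matrix.smul_mulVec, Matrix.mulVec_mulVec, Matrix.mul_assoc,
        hUU, Matrix.mul_one, ← Matrix.mulVec_mulVec, Matrix.diagonal_mulVec_single]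
      rw [show (Pi.single j (Complex.exp (2 * Real.pi * Complex.I * (m j : ℂ)) * 1) : Fin p → ℂ) = Complex.exp (2 * Real.pi * Complex.I * (m j : ℂ)) • Pi.single j 1 by simp [← Pi.single_smul]]
      rw [Matrix.mulVec_smul]
      simp only [smul_smul, Complex.one_cpow, mul_one, ← Complex.exp_nat_mul, ← Complex.exp_neg, ← Complex.exp_add]
      congr 1
      rw [Complex.exp_eq_exp_iff_exists_int]
      refine ⟨-ν, ?_⟩
      field_simp
      push_cast
      ring
    rw [slashRep]
    change _ *ᵥ slash k v f (T ^ M) τ = _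
    rw [← hinv, Matrix.mulVec_mulVec]
    have : ((ρ ⟨T ^ M, T_pow_mem hM⟩)⁻¹ : GL (Fin p) ℂ).1 * (ρ ⟨T ^ M, T_pow_mem hM⟩).1 = 1 :=
      Units.inv_mul _
    rw [this, Matrix.one_mulVec]
  have key : ∀ g (hg : g ∈ cuspStabilizer Γ), slashRep k v ρ f ⟨g, hg.1⟩ = f := by
    suffices cuspStabilizer Γ ≤ Subgroup.map Γ.subtype
        { carrier := {γ : Γ | slashRep k v ρ f γ = f}
          one_mem' := slashRep_one hv ρ f
          mul_mem' := fun {a b} ha hb => by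
            change slashRep k v ρ f (a * b) = f
            change slashRep k v ρ f a = f at ha
            change slashRep k v ρ f b = f at hb
            rw [slashRep_mul hv, ha, hb]
          inv_mem' := fun {a} ha => by
            change slashRep k v ρ f a⁻¹ = f
            change slashRep k v ρ f a = f at ha
            have := slashRep_mul hv ρ f a a⁻¹
            rw [mul_inv_cancel, slashRep_one hv, ha] at this
            exact this.symm } by
      intro g hg
      obtain ⟨x, hx, rfl⟩ := this hg
      exact hx
    rw [hM, Subgroup.closure_le]
    rintro g (rfl | rfl)
    · exact ⟨⟨T ^ M, T_pow_mem hM⟩, hT, rfl⟩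
    · refine ⟨⟨-1, hneg⟩ * ⟨T ^ M, T_pow_mem hM⟩, ?_, by simp⟩
      change slashRep k v ρ f _ = f
      rw [slashRep_mul hv, hneg', hT]
  exact fun l hl => key l.1 hl

end VVMF

end

/-! Pairing a cusp form `F` with the Poincaré series of index `(ν, j)` in the Petersson product
gives, up to a nonzero constant, the Fourier coefficient of `(UF)_j` at the frequency `(ν + m_j)/M`.
These are all the frequencies that a cusp form can have at `∞`, so an `F` orthogonal to every series
has `UF = 0`, hence `F = 0` (`eq_zero_of_integral_pairing_eq_zero`). A subspace of a
finite-dimensional space with trivial orthogonal complement is the whole space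
(`span_eq_of_integral_pairing`).

The pairing is computed by unfolding, without a fundamental domain. One integrates over all of `ℍ`
against a weight `w` whose sum over each `Γ`-orbit is `1`; this is the Petersson product up to a
constant factor. Summing over `Γ` and changing variables replaces `w` by a weight for `Γ_∞`
supported on a vertical strip (`integrable_and_integral_unfold`), where Fubini yields a Fourier
coefficient times a Gamma integral.

Finite dimensionality (`finiteDimensional_cuspSubmodule`) rests on the boundedness of `‖F(τ)‖ (Im
τ)^(k/2)`: if enough Fourier coefficients at finitely many cusp representatives vanish, any bound
can be halved, so `F = 0`.

For `k > 2` the lattice sum of `‖(c, d)‖^(-k)` dominates the Poincaré series, which gives absolute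
convergence and holomorphy; dominated convergence gives vanishing at the cusps. Normality of `ρ`
makes every `F|_k σ` periodic, so that vanishing at the cusps is equivalent to the required
expansions (`cuspForms_eq_cuspSubmodule`). -/

noncomputable section

namespace VVMF

open MeasureTheory Filter Topology

/-! ### Fourier coefficients along horizontal lines -/

/-- The mean value of `f(τ) e^{-2πiaτ}` over the segment `Im τ = y`, `0 ≤ Re τ ≤ P`. -/
def horizontalCoeff (f : ℍ → ℂ) (P a y : ℝ) : ℂ :=
  (1 / P : ℝ) • ∫ x in (0 : ℝ)..P, f (ofComplex (x + y * Complex.I)) *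
    Complex.exp (-(2 * Real.pi * Complex.I * a * (x + y * Complex.I)))

theorem continuous_comp_ofComplex_horizontal {f : ℍ → ℂ} (hf : Continuous f) {y : ℝ}
    (hy : 0 < y) : Continuous fun x : ℝ => f (ofComplex (x + y * Complex.I)) := by
  have : Continuous fun x : ℝ => (⟨x + y * Complex.I, by simpa using hy⟩ : ℍ) := by
    rw [isOpenEmbedding_coe.isEmbedding.continuous_iff]
    change Continuous fun x : ℝ => (x + y * Complex.I : ℂ)
    fun_prop
  refine (hf.comp this).congr fun x => ?_
  rw [Function.comp_apply, ofComplex_apply_of_im_pos (by simpa using hy)]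

theorem continuous_horizontalCoeff_integrand {f : ℍ → ℂ} (hf : Continuous f) (a : ℝ) {y : ℝ}
    (hy : 0 < y) : Continuous fun x : ℝ => f (ofComplex (x + y * Complex.I)) *
      Complex.exp (-(2 * Real.pi * Complex.I * a * (x + y * Complex.I))) :=
  (continuous_comp_ofComplex_horizontal hf hy).mul (by fun_prop)

theorem horizontalCoeff_add {f g : ℍ → ℂ} (hf : Continuous f) (hg : Continuous g) (P a : ℝ)
    {y : ℝ} (hy : 0 < y) :
    horizontalCoeff (fun τ => f τ + g τ) P a y =
      horizontalCoeff f P a y + horizontalCoeff g P a y := by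
  simp only [horizontalCoeff, add_mul]
  rw [intervalIntegral.integral_add
    ((continuous_horizontalCoeff_integrand hf a hy).intervalIntegrable _ _)
    ((continuous_horizontalCoeff_integrand hg a hy).intervalIntegrable _ _), smul_add]

theorem horizontalCoeff_const_mul (c : ℂ) (f : ℍ → ℂ) (P a y : ℝ) :
    horizontalCoeff (fun τ => c * f τ) P a y = c * horizontalCoeff f P a y := by
  simp only [horizontalCoeff, mul_assoc]
  rw [intervalIntegral.integral_const_mul, mul_smul_comm]

theorem norm_exp_neg_two_pi_I_mul (a x y : ℝ) :
    ‖Complex.exp (-(2 * Real.pi * Complex.I * a * (x + y * Complex.I)))‖ =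
      Real.exp (2 * Real.pi * a * y) := by
  rw [Complex.norm_exp]
  congr 1
  simp [mul_assoc]

theorem norm_horizontalCoeff_le {f : ℍ → ℂ} {P : ℝ} (hP : 0 < P) (a : ℝ) {y : ℝ} (hy : 0 < y)
    {A : ℝ} (hA : ∀ τ : ℍ, τ.im = y → ‖f τ‖ ≤ A) :
    ‖horizontalCoeff f P a y‖ ≤ A * Real.exp (2 * Real.pi * a * y) := by
  rw [horizontalCoeff, norm_smul, Real.norm_of_nonneg (by positivity)]
  have := intervalIntegral.norm_integral_le_of_norm_le_const (a := 0) (b := P)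
    (C := A * Real.exp (2 * Real.pi * a * y))
    (f := fun x : ℝ => f (ofComplex (x + y * Complex.I)) *
      Complex.exp (-(2 * Real.pi * Complex.I * a * (x + y * Complex.I)))) (by
      intro x _
      rw [norm_mul, norm_exp_neg_two_pi_I_mul]
      gcongr
      apply hA
      rw [ofComplex_apply_of_im_pos (by simpa using hy)]
      simp [UpperHalfPlane.im])
  rw [sub_zero, abs_of_pos hP] at this
  calc _ ≤ 1 / P * (A * Real.exp (2 * Real.pi * a * y) * P) := by gcongr
    _ = _ := by field_simp

/-- Cauchy's theorem on a rectangle of width `P`: the automorphy assumption makes `f(τ) e^{-2πiaτ}`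
periodic, so the vertical sides cancel. -/
theorem horizontalCoeff_eq {f : ℍ → ℂ} (hf : MDifferentiable 𝓘(ℂ) 𝓘(ℂ) f) {P : ℝ} (a : ℝ)
    (hper : ∀ τ : ℍ, f (P +ᵥ τ) = Complex.exp (2 * Real.pi * Complex.I * a * P) * f τ)
    {y y' : ℝ} (hy : 0 < y) (hy' : 0 < y') :
    horizontalCoeff f P a y = horizontalCoeff f P a y' := by
  set g : ℂ → ℂ := fun z => f (ofComplex z) * Complex.exp (-(2 * Real.pi * Complex.I * a * z))
    with hg
  have hd : DifferentiableOn ℂ g {z | 0 < z.im} :=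
    (UpperHalfPlane.mdifferentiable_iff.mp hf).mul (by fun_prop)
  have hper' : ∀ z : ℂ, 0 < z.im → g (P + z) = g z := by
    intro z hz
    have h := hper ⟨z, hz⟩
    have e : P +ᵥ (⟨z, hz⟩ : ℍ) = ofComplex (P + z) := by
      rw [ofComplex_apply_of_im_pos (by simpa using hz)]
      ext
      simp
    rw [e] at h
    simp only [hg]
    rw [h, ofComplex_apply_of_im_pos hz, mul_right_comm, ← Complex.exp_add, mul_comm]
    congr 2
    ring
  have hR := Complex.integral_boundary_rect_eq_zero_of_differentiableOn g (⟨0, y⟩ : ℂ) ⟨P, y'⟩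
    (hd.mono fun z hz => lt_of_lt_of_le (lt_min hy hy') hz.2.1)
  have hside : ∫ t : ℝ in y..y', g (P + t * Complex.I) = ∫ t : ℝ in y..y', g (t * Complex.I) := by
    refine intervalIntegral.integral_congr fun t ht => hper' _ ?_
    simpa using lt_of_lt_of_le (lt_min hy hy') ht.1
  simp only [Complex.ofReal_zero, zero_add, hside] at hR
  rw [add_sub_cancel_right, sub_eq_zero] at hR
  simp only [horizontalCoeff]
  rw [hR]

/-- The coefficient does not depend on the height, and at great height it is at most `ε e^{2πay} ≤
ε` because `a ≤ 0`. -/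
theorem horizontalCoeff_eq_zero {f : ℍ → ℂ} (hf : MDifferentiable 𝓘(ℂ) 𝓘(ℂ) f) {P : ℝ}
    (hP : 0 < P) {a : ℝ} (ha : a ≤ 0)
    (hper : ∀ τ : ℍ, f (P +ᵥ τ) = Complex.exp (2 * Real.pi * Complex.I * a * P) * f τ)
    (h0 : IsZeroAtImInfty f) {y : ℝ} (hy : 0 < y) : horizontalCoeff f P a y = 0 := by
  refine norm_le_zero_iff.mp (le_of_forall_pos_le_add fun ε hε => ?_)
  obtain ⟨A, hA⟩ := isZeroAtImInfty_iff.mp h0 ε hε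
  rw [horizontalCoeff_eq hf a hper hy (show 0 < max A 1 by positivity), zero_add]
  refine (norm_horizontalCoeff_le hP a (by positivity) (A := ε) fun τ hτ => hA τ ?_).trans ?_
  · rw [hτ]; exact le_max_left _ _
  · refine mul_le_of_le_one_right hε.le (Real.exp_le_one_iff.mpr ?_)
    have : 0 < max A 1 := by positivity
    have : 2 * Real.pi * a ≤ 0 := mul_nonpos_of_nonneg_of_nonpos (by positivity) ha
    exact mul_nonpos_of_nonpos_of_nonneg this (by positivity)

/-- This is the Fourier series of `x ↦ f(x + iy)` on the circle of length `P`. Holomorphy is not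
needed, since the coefficients are taken at the height of `τ` itself. -/
theorem hasSum_horizontalCoeff {f : ℍ → ℂ} (hf : Continuous f) {P : ℝ} (hP : 0 < P)
    (hper : ∀ τ : ℍ, f (P +ᵥ τ) = f τ) (τ : ℍ)
    (hs : Summable fun n : ℤ => ‖horizontalCoeff f P (n / P) τ.im‖ *
      Real.exp (-(2 * Real.pi * (n / P) * τ.im))) :
    HasSum (fun n : ℤ => horizontalCoeff f P (n / P) τ.im *
      Complex.exp (2 * Real.pi * Complex.I * (n / P) * τ)) (f τ) := by
  have : Fact (0 < P) := ⟨hP⟩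
  set y := τ.im with hy
  have hy0 : 0 < y := τ.im_pos
  have hcont := continuous_comp_ofComplex_horizontal hf hy0
  have hg : Function.Periodic (fun x : ℝ => f (ofComplex (x + y * Complex.I))) P := by
    intro x
    have e : ofComplex (((x + P : ℝ) : ℂ) + y * Complex.I) =
        P +ᵥ ofComplex ((x : ℂ) + y * Complex.I) := by
      rw [ofComplex_apply_of_im_pos (by simpa using hy0),
        ofComplex_apply_of_im_pos (by simpa using hy0)]
      ext
      simp
      ring
    simp only [e, hper]
  let G : C(AddCircle P, ℂ) := ⟨hg.lift, continuous_coinduced_dom.mpr hcont⟩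
  have hG : ∀ x : ℝ, G x = f (ofComplex (x + y * Complex.I)) := fun x => hg.lift_coe x
  have hcoeff : ∀ n : ℤ, fourierCoeff G n = horizontalCoeff f P (n / P) y *
      Complex.exp (2 * Real.pi * Complex.I * (n / P) * (y * Complex.I)) := by
    intro n
    rw [fourierCoeff_eq_intervalIntegral _ n 0, zero_add, horizontalCoeff, smul_mul_assoc,
      ← intervalIntegral.integral_mul_const]
    congr 1
    refine intervalIntegral.integral_congr fun x _ => ?_
    simp only [hG, smul_eq_mul, fourier_coe_apply]
    rw [mul_assoc (f _), ← Complex.exp_add, mul_comm]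
    congr 2
    have : (P : ℂ) ≠ 0 := by exact_mod_cast hP.ne'
    push_cast
    field_simp
    ring
  have hsum : Summable (fourierCoeff G) := by
    refine Summable.of_norm (hs.congr fun n => ?_)
    rw [hcoeff, norm_mul, Complex.norm_exp]
    congr 2
    rw [show 2 * (Real.pi : ℂ) * Complex.I * (n / P) * (y * Complex.I) =
      ((2 * Real.pi * (n / P) * y : ℝ) : ℂ) * (Complex.I * Complex.I) by push_cast; ring,
      Complex.I_mul_I]
    simp
  have key := has_pointwise_sum_fourier_series_of_summable hsum (τ.re : AddCircle P)
  have hτ : (τ.re : ℂ) + y * Complex.I = τ := by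
    exact Complex.re_add_im τ
  rw [hG, hτ, ofComplex_apply] at key
  refine key.congr_fun fun n => ?_
  rw [hcoeff, smul_eq_mul, fourier_coe_apply, mul_assoc (horizontalCoeff _ _ _ _), ← Complex.exp_add]
  congr 2
  nth_rewrite 1 [← hτ]
  have : (P : ℂ) ≠ 0 := by exact_mod_cast hP.ne'
  field_simp
  ring

theorem exists_re_mem_Icc_of_periodic {E : Type*} {f : ℍ → E} {P : ℝ} (hP : 0 < P)
    (hper : ∀ τ : ℍ, f (P +ᵥ τ) = f τ) (τ : ℍ) :
    ∃ τ' : ℍ, τ'.im = τ.im ∧ τ'.re ∈ Set.Icc 0 P ∧ f τ' = f τ := by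
  have hint : ∀ (n : ℤ) (τ : ℍ), f ((n * P : ℝ) +ᵥ τ) = f τ := by
    intro n
    induction n with
    | zero => intro τ; simp
    | succ n ih =>
      intro τ
      rw [← ih τ, ← hper (((n : ℤ) * P : ℝ) +ᵥ τ), vadd_vadd]
      congr 2
      push_cast
      ring
    | pred n ih =>
      intro τ
      rw [← ih τ, ← hper _, vadd_vadd]
      congr 2
      push_cast
      ring
  have hre : ((-⌊τ.re / P⌋ : ℤ) * P : ℝ) + τ.re = Int.fract (τ.re / P) * P := by
    rw [Int.fract, sub_mul, div_mul_cancel₀ _ hP.ne']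
    push_cast
    ring
  refine ⟨((-⌊τ.re / P⌋ : ℤ) * P : ℝ) +ᵥ τ, vadd_im _ _, ?_, hint _ _⟩
  rw [vadd_re, hre]
  have h1 := Int.fract_nonneg (τ.re / P)
  have h2 := (Int.fract_lt_one (τ.re / P)).le
  exact ⟨by positivity, by nlinarith⟩

theorem exists_norm_le_of_im_eq {f : ℍ → ℂ} (hf : Continuous f) {P : ℝ} (hP : 0 < P)
    (hper : ∀ τ : ℍ, f (P +ᵥ τ) = f τ) {y : ℝ} (hy : 0 < y) :
    ∃ A, ∀ τ : ℍ, τ.im = y → ‖f τ‖ ≤ A := by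
  obtain ⟨A, hA⟩ := (isCompact_Icc (a := (0 : ℝ)) (b := P)).exists_bound_of_continuousOn
    (continuous_comp_ofComplex_horizontal hf hy).continuousOn
  refine ⟨A, fun τ hτ => ?_⟩
  obtain ⟨τ', him, hre, hfτ⟩ := exists_re_mem_Icc_of_periodic hP hper τ
  have hτ' : (τ'.re : ℂ) + y * Complex.I = τ' := by
    rw [← hτ, ← him]
    exact Complex.re_add_im τ'
  have := hA τ'.re hre
  rwa [hτ', ofComplex_apply, hfτ] at this

/-- The `q`-expansion of a holomorphic periodic function on `ℍ` whose Fourier coefficients of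
index `< L` vanish, together with the resulting decay. -/
theorem hasSum_and_norm_le_of_horizontalCoeff_eq_zero {f : ℍ → ℂ}
    (hf : MDifferentiable 𝓘(ℂ) 𝓘(ℂ) f) {P : ℝ} (hP : 0 < P)
    (hper : ∀ τ : ℍ, f (P +ᵥ τ) = f τ) (L : ℕ)
    (hL : ∀ n : ℤ, n < L → horizontalCoeff f P (n / P) 1 = 0) (τ : ℍ) {y A : ℝ} (hy : 0 < y)
    (hyτ : y < τ.im) (hA : ∀ τ : ℍ, τ.im = y → ‖f τ‖ ≤ A) :
    HasSum (fun n : ℕ => horizontalCoeff f P (((L : ℤ) + n : ℤ) / P) 1 *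
      Complex.exp (2 * Real.pi * Complex.I * (((L : ℤ) + n : ℤ) / P) * τ)) (f τ) ∧
    ‖f τ‖ ≤ A * (Real.exp (-(2 * Real.pi * (τ.im - y) / P)) ^ L /
      (1 - Real.exp (-(2 * Real.pi * (τ.im - y) / P)))) := by
  set r := Real.exp (-(2 * Real.pi * (τ.im - y) / P)) with hr
  have hr0 : 0 < r := Real.exp_pos _
  have hr1 : r < 1 := by
    rw [hr, Real.exp_lt_one_iff, neg_lt_zero]
    have := sub_pos.mpr hyτ
    positivity
  have hcont := hf.continuous
  have hper' : ∀ (n : ℤ) (τ : ℍ), f (P +ᵥ τ) =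
      Complex.exp (2 * Real.pi * Complex.I * ((n / P : ℝ) : ℂ) * P) * f τ := by
    intro n τ
    have : (P : ℂ) ≠ 0 := by exact_mod_cast hP.ne'
    rw [show 2 * (Real.pi : ℂ) * Complex.I * ((n / P : ℝ) : ℂ) * P =
      n * (2 * Real.pi * Complex.I) by push_cast; field_simp, Complex.exp_int_mul_two_pi_mul_I,
      one_mul, hper]
  have hconst : ∀ (n : ℤ) {y' : ℝ}, 0 < y' →
      horizontalCoeff f P (n / P) y' = horizontalCoeff f P (n / P) 1 := fun n y' hy' =>
    horizontalCoeff_eq hf _ (hper' n) hy' one_pos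
  have hsupp : Function.Injective fun n : ℕ => ((L : ℤ) + n : ℤ) := fun a b h => by simpa using h
  have hrange : ∀ n : ℤ, n ∉ Set.range (fun n : ℕ => ((L : ℤ) + n : ℤ)) →
      horizontalCoeff f P (n / P) 1 = 0 := by
    intro n hn
    refine hL n (not_le.mp fun h => hn ⟨(n - L).toNat, ?_⟩)
    have := Int.toNat_of_nonneg (sub_nonneg.mpr h)
    simp only
    omega
  -- Estimating the coefficient at the lower height `y` and evaluating at `Im τ > y` gains the
  -- factor `r` per unit of frequency index.
  have hbd : ∀ n : ℕ, ‖horizontalCoeff f P (((L : ℤ) + n : ℤ) / P) 1‖ *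
      Real.exp (-(2 * Real.pi * (((L : ℤ) + n : ℤ) / P) * τ.im)) ≤ A * r ^ L * r ^ n := by
    intro n
    rw [← hconst _ hy]
    have h := norm_horizontalCoeff_le (f := f) hP (((L : ℤ) + n : ℤ) / P) hy hA
    calc _ ≤ A * Real.exp (2 * Real.pi * (((L : ℤ) + n : ℤ) / P) * y) *
        Real.exp (-(2 * Real.pi * (((L : ℤ) + n : ℤ) / P) * τ.im)) := by gcongr
      _ = _ := by
        rw [mul_assoc, mul_assoc A, ← Real.exp_add, ← pow_add, hr, ← Real.exp_nat_mul]
        congr 2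
        push_cast
        field_simp
        ring
  have hgeo : HasSum (fun n : ℕ => A * r ^ L * r ^ n) (A * r ^ L * (1 - r)⁻¹) :=
    (hasSum_geometric_of_lt_one hr0.le hr1).mul_left _
  have hsumN := Summable.of_nonneg_of_le (fun n => by positivity) hbd hgeo.summable
  have hsumZ : Summable fun n : ℤ => ‖horizontalCoeff f P (n / P) τ.im‖ *
      Real.exp (-(2 * Real.pi * (n / P) * τ.im)) := by
    simp_rw [hconst _ τ.im_pos]
    refine (hsupp.summable_iff fun n hn => ?_).mp hsumN
    rw [hrange n hn, norm_zero, zero_mul]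
  have hZ := hasSum_horizontalCoeff hcont hP hper τ hsumZ
  simp_rw [hconst _ τ.im_pos] at hZ
  have hN := (hsupp.hasSum_iff fun n hn => by rw [hrange n hn, zero_mul]).mpr hZ
  simp only [Function.comp_def] at hN
  refine ⟨hN, ?_⟩
  rw [← hN.tsum_eq, mul_div_assoc', div_eq_mul_inv, ← hgeo.tsum_eq]
  refine tsum_of_norm_bounded hgeo.summable.hasSum fun n => ?_
  refine le_trans (le_of_eq ?_) (hbd n)
  rw [norm_mul, Complex.norm_exp]
  congr 2
  rw [show 2 * (Real.pi : ℂ) * Complex.I * ((((L : ℤ) + n : ℤ) : ℂ) / P) * τ =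
    ((2 * Real.pi * (((L : ℤ) + n : ℤ) / P) : ℝ) : ℂ) * (Complex.I * τ) by push_cast; ring]
  rw [Complex.re_ofReal_mul]
  simp

/-! ### Unfolding -/

section Unfolding

variable {G X : Type*} [Group G] [MulAction G X]

/-- Every element of `G` is uniquely `l * r` with `l ∈ Λ` and `r` a chosen representative of a
right coset of `Λ`. -/
def rightCosetsProdEquiv (Λ : Subgroup G) : Quotient (QuotientGroup.rightRel Λ) × Λ ≃ G :=
  Equiv.ofBijective (fun z => (z.2 : G) * z.1.out) <| by
    constructor
    · rintro ⟨q, l⟩ ⟨q', l'⟩ h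
      simp only at h
      have hq : q = q' := by
        rw [← q.out_eq, ← q'.out_eq, Quotient.eq, QuotientGroup.rightRel_apply]
        have : q'.out * q.out⁻¹ = ((l'⁻¹ * l : Λ) : G) := by
          rw [mul_inv_eq_iff_eq_mul, Subgroup.coe_mul, mul_assoc, h]
          simp
        rw [this]
        exact (l'⁻¹ * l).2
      subst hq
      rw [mul_left_inj] at h
      rw [Subtype.ext h]
    · intro g
      have h : g * (Quotient.mk (QuotientGroup.rightRel Λ) g).out⁻¹ ∈ Λ := by
        rw [← QuotientGroup.rightRel_apply]
        exact Quotient.mk_out g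
      exact ⟨⟨Quotient.mk _ g, ⟨_, h⟩⟩, by simp⟩

/-- Write `g = l * q.out`. By `Λ`-invariance `h` sees only `q`, and the sum of `u` over `l` is `1`.
Absolute convergence over the product justifies the regrouping. -/
theorem hasSum_mul_comp_smul (Λ : Subgroup G) {u : X → ℝ} (hu0 : ∀ x, 0 ≤ u x)
    (hu : ∀ x, HasSum (fun l : Λ => u ((l : G) • x)) 1) {h : X → ℂ}
    (hΛ : ∀ l ∈ Λ, ∀ x, h (l • x) = h x) (x : X)
    (hs : Summable fun q : Quotient (QuotientGroup.rightRel Λ) => ‖h (q.out • x)‖) :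
    HasSum (fun g : G => (u (g • x) : ℂ) * h (g • x))
      (∑' q : Quotient (QuotientGroup.rightRel Λ), h (q.out • x)) := by
  rw [← (rightCosetsProdEquiv Λ).hasSum_iff]
  have hval : ∀ z : Quotient (QuotientGroup.rightRel Λ) × Λ,
      ((fun g : G => (u (g • x) : ℂ) * h (g • x)) ∘ rightCosetsProdEquiv Λ) z =
        (u ((z.2 : G) • z.1.out • x) : ℂ) * h (z.1.out • x) := by
    rintro ⟨q, l⟩
    change (u (((l : G) * q.out) • x) : ℂ) * h (((l : G) * q.out) • x) = _
    rw [mul_smul, hΛ _ l.2]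
  have hfib : ∀ q : Quotient (QuotientGroup.rightRel Λ),
      HasSum (fun l : Λ => (u ((l : G) • q.out • x) : ℂ) * h (q.out • x)) (h (q.out • x)) := by
    intro q
    have := (Complex.hasSum_ofReal.mpr (hu (q.out • x))).mul_right (h (q.out • x))
    simpa using this
  have hfibn : ∀ q : Quotient (QuotientGroup.rightRel Λ),
      HasSum (fun l : Λ => u ((l : G) • q.out • x) * ‖h (q.out • x)‖) ‖h (q.out • x)‖ := by
    intro q
    simpa using (hu (q.out • x)).mul_right ‖h (q.out • x)‖
  have hS : Summable fun z : Quotient (QuotientGroup.rightRel Λ) × Λ =>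
      (u ((z.2 : G) • z.1.out • x) : ℂ) * h (z.1.out • x) := by
    refine Summable.of_norm ?_
    simp only [norm_mul, Complex.norm_real, Real.norm_of_nonneg (hu0 _)]
    refine (summable_prod_of_nonneg fun z => mul_nonneg (hu0 _) (norm_nonneg _)).mpr
      ⟨fun q => (hfibn q).summable, ?_⟩
    simpa only [(hfibn _).tsum_eq] using hs
  simp_rw [funext hval]
  have := hS.hasSum.prod_fiberwise hfib
  rw [this.tsum_eq]
  exact hS.hasSum

variable [Countable G] [MeasurableSpace X] {μ : Measure X} [MeasurableConstSMul G X]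
  [SMulInvariantMeasure G X μ]

/-- Unfolding of `∑_{q ∈ Λ\G} h(q x)` against a weight function `w` whose `G`-translates sum up
to `1`, where `u` is a weight function for `Λ`. -/
theorem integrable_and_integral_unfold (Λ : Subgroup G) {w u : X → ℝ} (hwm : Measurable w)
    (hw0 : ∀ x, 0 ≤ w x) (hw : ∀ x, HasSum (fun g : G => w (g • x)) 1)
    (hu0 : ∀ x, 0 ≤ u x) (hu : ∀ x, HasSum (fun l : Λ => u ((l : G) • x)) 1) {h : X → ℂ}
    (hΛ : ∀ l ∈ Λ, ∀ x, h (l • x) = h x) (hint : Integrable (fun x => (u x : ℂ) * h x) μ)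
    (hs : ∀ x, Summable fun q : Quotient (QuotientGroup.rightRel Λ) => ‖h (q.out • x)‖)
    (hm : AEStronglyMeasurable
      (fun x => ∑' q : Quotient (QuotientGroup.rightRel Λ), h (q.out • x)) μ) :
    Integrable
      (fun x => (w x : ℂ) * ∑' q : Quotient (QuotientGroup.rightRel Λ), h (q.out • x)) μ ∧
    ∫ x, (w x : ℂ) * ∑' q : Quotient (QuotientGroup.rightRel Λ), h (q.out • x) ∂μ =
      ∫ x, (u x : ℂ) * h x ∂μ := by
  set f : X → ℂ := fun x => (u x : ℂ) * h x with hf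
  have hwm' : Measurable fun x => (w x : ℂ) := Complex.measurable_ofReal.comp hwm
  have hw1 : ∀ x, ‖(w x : ℂ)‖ ≤ 1 := by
    intro x
    rw [Complex.norm_real, Real.norm_of_nonneg (hw0 x)]
    simpa using le_hasSum (hw x) 1 fun g _ => hw0 _
  have hinv : ∀ x, HasSum (fun g : G => w (g⁻¹ • x)) 1 := fun x =>
    ((Equiv.inv G).hasSum_iff (f := fun g : G => w (g • x))).mpr (hw x)
  -- The two families correspond under the measure-preserving substitution `x ↦ g x`. Summed over
  -- `g`, the first gives the series times `w`, the second gives `f`, because the translates of `w`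
  -- add up to `1`.
  let K : G → X → ℂ := fun g x => (w x : ℂ) * f (g • x)
  let K' : G → X → ℂ := fun g x => (w (g⁻¹ • x) : ℂ) * f x
  have hKK' : ∀ g x, K' g (g • x) = K g x := fun g x => by simp [K, K']
  have hK'i : ∀ g, Integrable (K' g) μ := fun g =>
    hint.bdd_mul (c := 1) (hwm'.comp (measurable_const_smul _)).aestronglyMeasurable
      (ae_of_all _ fun x => hw1 _)
  have hKi : ∀ g, Integrable (K g) μ := fun g => by
    have := (measurePreserving_smul g μ).integrable_comp_of_integrable (hK'i g)
    exact this.congr (ae_of_all _ fun x => hKK' g x)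
  have hKI : ∀ g, ∫ x, K g x ∂μ = ∫ x, K' g x ∂μ := fun g => by
    rw [← integral_smul_eq_self (K' g) (g := g)]
    simp_rw [hKK']
  have hKN : ∀ g, ∫ x, ‖K g x‖ ∂μ = ∫ x, ‖K' g x‖ ∂μ := fun g => by
    rw [← integral_smul_eq_self (fun x => ‖K' g x‖) (g := g)]
    simp_rw [hKK']
  -- Finite partial sums of the integrals are at most `∫ ‖f‖`, since partial sums of the translates
  -- of `w` are at most `1`.
  have hsum' : Summable fun g => ∫ x, ‖K' g x‖ ∂μ := by
    refine summable_of_sum_le (fun g => integral_nonneg fun x => norm_nonneg _)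
      (c := ∫ x, ‖f x‖ ∂μ) fun s => ?_
    rw [← integral_finsetSum _ fun g _ => (hK'i g).norm]
    refine integral_mono (integrable_finsetSum _ fun g _ => (hK'i g).norm) hint.norm fun x => ?_
    simp only [K', norm_mul, Complex.norm_real, Real.norm_of_nonneg (hw0 _)]
    rw [← Finset.sum_mul]
    exact mul_le_of_le_one_left (norm_nonneg _) (sum_le_hasSum _ (fun g _ => hw0 _) (hinv x))
  have hsum : Summable fun g => ∫ x, ‖K g x‖ ∂μ := by simpa only [hKN] using hsum'
  have hKsum : ∀ x, HasSum (fun g => K g x)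
      ((w x : ℂ) * ∑' q : Quotient (QuotientGroup.rightRel Λ), h (q.out • x)) := fun x =>
    (hasSum_mul_comp_smul Λ hu0 hu hΛ x (hs x)).mul_left _
  have hK'sum : ∀ x, HasSum (fun g => K' g x) (f x) := fun x => by
    simpa using (Complex.hasSum_ofReal.mpr (hinv x)).mul_right (f x)
  have h1 := hasSum_integral_of_summable_integral_norm hKi hsum
  have h2 := hasSum_integral_of_summable_integral_norm hK'i hsum'
  simp_rw [(hKsum _).tsum_eq] at h1
  simp_rw [(hK'sum _).tsum_eq] at h2
  refine ⟨⟨hwm'.aestronglyMeasurable.mul hm, ?_⟩, ?_⟩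
  · simp_rw [← (hKsum _).tsum_eq]
    refine lt_of_le_of_lt (lintegral_mono fun x => enorm_tsum_le_tsum_enorm) ?_
    rw [lintegral_tsum fun g => (hKi g).aestronglyMeasurable.enorm]
    simp_rw [← ofReal_integral_norm_eq_lintegral_enorm (hKi _)]
    rw [← ENNReal.ofReal_tsum_of_nonneg (fun g => integral_nonneg fun x => norm_nonneg _) hsum]
    exact ENNReal.ofReal_lt_top
  · refine h1.unique ?_
    simpa only [hKI] using h2

end Unfolding

/-! ### The hyperbolic measure -/

instance : MeasurableConstSMul SL(2, ℤ) ℍ :=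
  ⟨fun g => (continuous_const_smul (Matrix.SpecialLinearGroup.mapGL ℝ g)).measurable⟩

instance : SMulInvariantMeasure SL(2, ℤ) ℍ volume :=
  ⟨fun g s hs => by
    have := SMulInvariantMeasure.measure_preimage_smul (μ := (volume : Measure ℍ))
      (Matrix.SpecialLinearGroup.mapGL ℝ g) hs
    exact this⟩

/-- The invariant measure has density `y⁻²` with respect to Lebesgue measure; the factor `(Im τ)²`
in the hypothesis cancels it. -/
theorem integrable_and_integral_upperHalfPlane {f : ℍ → ℂ} {F : ℝ × ℝ → ℂ}
    (hfF : ∀ τ : ℍ, f τ = (τ.im ^ 2 : ℝ) • F (τ.re, τ.im))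
    (hF : IntegrableOn F (Set.univ ×ˢ Set.Ioi 0)) :
    Integrable f ∧ ∫ τ, f τ = ∫ z in Set.univ ×ˢ Set.Ioi 0, F z := by
  set d : ℍ → NNReal := fun z => (1 / NNReal.mk z.im z.im_pos.le) ^ 2 with hd
  have hdm : Measurable d := by
    refine Continuous.measurable ?_
    refine .pow (.div₀ continuous_const ?_ ?_) _
    · exact continuous_im.subtype_mk _
    · exact fun x => NNReal.ne_iff.mp x.im_ne_zero
  have hvol : (volume : Measure ℍ) =
      (Measure.comap UpperHalfPlane.coe volume).withDensity fun z => (d z : ENNReal) := volume_def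
  have hcoe : MeasurePreserving UpperHalfPlane.coe (Measure.comap UpperHalfPlane.coe volume)
      (volume.restrict (Set.range UpperHalfPlane.coe)) :=
    ⟨measurable_coe, by rw [measurableEmbedding_coe.map_comap]⟩
  have hdf : ∀ τ : ℍ, d τ • f τ = F (Complex.measurableEquivRealProd τ) := by
    intro τ
    rw [hfF, NNReal.smul_def, smul_smul]
    have := τ.im_ne_zero
    have e : ((d τ : ℝ)) * τ.im ^ 2 = 1 := by
      simp [hd, field]
    rw [e, one_smul]
    rfl
  have hset : Complex.measurableEquivRealProd ⁻¹' (Set.univ ×ˢ Set.Ioi 0) =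
      Set.range UpperHalfPlane.coe := by
    ext z
    simp [Complex.measurableEquivRealProd]
  have hprod : MeasurePreserving Complex.measurableEquivRealProd
      (volume.restrict (Set.range UpperHalfPlane.coe))
      (volume.restrict (Set.univ ×ˢ Set.Ioi 0)) := by
    rw [← hset]
    exact Complex.volume_preserving_equiv_real_prod.restrict_preimage
      (MeasurableSet.univ.prod measurableSet_Ioi)
  have hcomp := hprod.comp hcoe
  have hemb := Complex.measurableEquivRealProd.measurableEmbedding.comp measurableEmbedding_coe
  rw [hvol, integrable_withDensity_iff_integrable_smul hdm,
    integral_withDensity_eq_integral_smul hdm]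
  simp_rw [hdf]
  exact ⟨hcomp.integrable_comp_of_integrable hF, hcomp.integral_comp hemb F⟩

variable {p : ℕ}

/-! ### The slash action -/

theorem jFactor_eq_denom (γ : SL(2, ℤ)) (τ : ℍ) :
    jFactor γ τ = denom (Matrix.SpecialLinearGroup.toGL
      ((Matrix.SpecialLinearGroup.map (Int.castRingHom ℝ)) γ)) τ :=
  (ModularGroup.denom_apply γ τ).symm

theorem jFactor_ne_zero (γ : SL(2, ℤ)) (τ : ℍ) : jFactor γ τ ≠ 0 := by
  rw [jFactor_eq_denom]
  exact denom_ne_zero _ _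

theorem im_smul_eq_div_norm_jFactor (γ : SL(2, ℤ)) (τ : ℍ) :
    (γ • τ).im = τ.im / ‖jFactor γ τ‖ ^ 2 := by
  rw [ModularGroup.im_smul_eq_div_normSq, jFactor_eq_denom, Complex.normSq_eq_norm_sq]

theorem norm_jFactor_rpow_mul_im_rpow (k : ℝ) (γ : SL(2, ℤ)) (τ : ℍ) :
    ‖jFactor γ τ‖ ^ (-k) * τ.im ^ (k / 2) = (γ • τ).im ^ (k / 2) := by
  have hj : 0 < ‖jFactor γ τ‖ := norm_pos_iff.mpr (jFactor_ne_zero γ τ)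
  rw [im_smul_eq_div_norm_jFactor, Real.div_rpow τ.im_pos.le (by positivity),
    ← Real.rpow_natCast, ← Real.rpow_mul hj.le, Real.rpow_neg hj.le]
  rw [show ((2 : ℕ) : ℝ) * (k / 2) = k by push_cast; ring]
  field_simp

theorem norm_slash_factor (k : ℝ) (v : SL(2, ℤ) → Circle) (γ : SL(2, ℤ)) (τ : ℍ) :
    ‖(v γ : ℂ)⁻¹ * jFactor γ τ ^ (-(k : ℂ))‖ = ‖jFactor γ τ‖ ^ (-k) := by
  rw [norm_mul, norm_inv, Circle.norm_coe, inv_one, one_mul, ← Complex.ofReal_neg,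
    Complex.norm_cpow_real]

theorem norm_slash {E : Type*} [SeminormedAddCommGroup E] [NormedSpace ℂ E] (k : ℝ)
    (v : SL(2, ℤ) → Circle) (F : ℍ → E) (γ : SL(2, ℤ)) (τ : ℍ) :
    ‖slash k v F γ τ‖ = ‖jFactor γ τ‖ ^ (-k) * ‖F (γ • τ)‖ := by
  rw [slash, norm_smul, norm_slash_factor]

/-- The multiplier has modulus one and `Im (γτ) = Im τ / |j|²`, so the weight-`k` factor is absorbed
by `(Im τ)^(k/2)`. -/
theorem norm_slash_mul_im_rpow {E : Type*} [SeminormedAddCommGroup E] [NormedSpace ℂ E] (k : ℝ)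
    (v : SL(2, ℤ) → Circle) (F : ℍ → E) (γ : SL(2, ℤ)) (τ : ℍ) :
    ‖slash k v F γ τ‖ * τ.im ^ (k / 2) = ‖F (γ • τ)‖ * (γ • τ).im ^ (k / 2) := by
  rw [norm_slash, ← norm_jFactor_rpow_mul_im_rpow]
  ring

theorem slash_add {E : Type*} [AddCommGroup E] [Module ℂ E] (k : ℝ) (v : SL(2, ℤ) → Circle)
    (F G : ℍ → E) (γ : SL(2, ℤ)) (τ : ℍ) :
    slash k v (F + G) γ τ = slash k v F γ τ + slash k v G γ τ := by
  simp [slash]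

theorem slash_smul {E : Type*} [AddCommGroup E] [Module ℂ E] (k : ℝ) (v : SL(2, ℤ) → Circle)
    (c : ℂ) (F : ℍ → E) (γ : SL(2, ℤ)) (τ : ℍ) :
    slash k v (c • F) γ τ = c • slash k v F γ τ := by
  simp only [slash, Pi.smul_apply]
  rw [smul_comm]

theorem slash_mulVec (k : ℝ) (v : SL(2, ℤ) → Circle) (A : Matrix (Fin p) (Fin p) ℂ)
    (F : ℍ → Fin p → ℂ) (γ : SL(2, ℤ)) (τ : ℍ) :
    slash k v (fun τ => A *ᵥ F τ) γ τ = A *ᵥ slash k v F γ τ := by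
  simp [slash, Matrix.mulVec_smul]

theorem slash_one {E : Type*} [AddCommGroup E] [Module ℂ E] {k : ℝ} {v : SL(2, ℤ) → Circle}
    (hv : IsMultiplierSystem k v) (F : ℍ → E) : slash k v F 1 = F := by
  have h := hv 1 1 UpperHalfPlane.I
  simp [autFactor, jFactor] at h
  funext τ
  simp [slash, jFactor, h]

theorem mdifferentiable_smul_SL (γ : SL(2, ℤ)) :
    MDifferentiable 𝓘(ℂ) 𝓘(ℂ) fun τ : ℍ => γ • τ :=
  UpperHalfPlane.mdifferentiable_smul (g := Matrix.SpecialLinearGroup.mapGL ℝ γ) (by simp)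

theorem mdifferentiable_jFactor_cpow (γ : SL(2, ℤ)) (s : ℂ) :
    MDifferentiable 𝓘(ℂ) 𝓘(ℂ) fun τ : ℍ => jFactor γ τ ^ s := by
  -- The base is constant if `c = 0`; otherwise `Im (cz + d) = c Im z ≠ 0` keeps it off the branch
  -- cut.
  by_cases hc : γ 1 0 = 0
  · simp only [jFactor, hc, Int.cast_zero, zero_mul, zero_add]
    exact mdifferentiable_const
  · rw [UpperHalfPlane.mdifferentiable_iff]
    have : DifferentiableOn ℂ (fun z : ℂ => (((γ 1 0 : ℤ) : ℂ) * z + ((γ 1 1 : ℤ) : ℂ)) ^ s)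
        {z | 0 < z.im} := by
      intro z hz
      refine (DifferentiableAt.cpow_const (by fun_prop) (Or.inr ?_)).differentiableWithinAt
      simpa using ⟨hc, (ne_of_gt hz : z.im ≠ 0)⟩
    refine this.congr fun z hz => ?_
    simp only [Function.comp_apply, jFactor, ofComplex_apply_of_im_pos hz]

theorem mdifferentiable_slash (k : ℝ) (v : SL(2, ℤ) → Circle) {f : ℍ → ℂ}
    (hf : MDifferentiable 𝓘(ℂ) 𝓘(ℂ) f) (γ : SL(2, ℤ)) :
    MDifferentiable 𝓘(ℂ) 𝓘(ℂ) (slash k v f γ) := by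
  have h1 := (mdifferentiable_const (c := ((v γ : ℂ)⁻¹)) (I := 𝓘(ℂ)) (M := ℍ)
    (I' := 𝓘(ℂ))).mul (mdifferentiable_jFactor_cpow γ (-(k : ℂ)))
  exact h1.mul (hf.comp (mdifferentiable_smul_SL γ))

section Translations

variable {k : ℝ} {v : SL(2, ℤ) → Circle} {κ : ℝ}

theorem jFactor_T_pow (n : ℕ) (τ : ℍ) : jFactor (T ^ n) τ = 1 := by
  have := ModularGroup.coe_T_zpow n
  simp only [zpow_natCast] at this
  simp [jFactor, this]

theorem multiplier_T_pow (hv : IsMultiplierSystem k v)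
    (hκ : (v T : ℂ) = Complex.exp (2 * Real.pi * Complex.I * (κ : ℂ))) (n : ℕ) :
    (v (T ^ n) : ℂ) = Complex.exp (2 * Real.pi * Complex.I * κ * n) := by
  induction n with
  | zero =>
    have h := hv 1 1 UpperHalfPlane.I
    simp [autFactor, jFactor] at h
    simp [h]
  | succ n ih =>
    have h := hv (T ^ n) T UpperHalfPlane.I
    have h1 := jFactor_T_pow 1
    simp only [pow_one] at h1
    rw [← pow_succ] at h
    simp only [autFactor, jFactor_T_pow, h1, Complex.one_cpow, mul_one, ih, hκ] at h
    rw [h, ← Complex.exp_add]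
    congr 1
    push_cast
    ring

theorem T_pow_smul (n : ℕ) (τ : ℍ) : T ^ n • τ = (n : ℝ) +ᵥ τ := by
  have := UpperHalfPlane.modular_T_zpow_smul τ n
  rwa [zpow_natCast, Int.cast_natCast] at this

theorem slash_T_pow {E : Type*} [AddCommGroup E] [Module ℂ E] (hv : IsMultiplierSystem k v)
    (hκ : (v T : ℂ) = Complex.exp (2 * Real.pi * Complex.I * (κ : ℂ))) (F : ℍ → E) (n : ℕ)
    (τ : ℍ) : slash k v F (T ^ n) τ =
      Complex.exp (-(2 * Real.pi * Complex.I * κ * n)) • F ((n : ℝ) +ᵥ τ) := by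
  rw [slash, multiplier_T_pow hv hκ, jFactor_T_pow, Complex.one_cpow, mul_one, T_pow_smul,
    Complex.exp_neg]

end Translations

/-! ### Expansions and decay at the cusp -/

theorem HasExpansionFrom.exists_norm_le {h : ℤ} (hh : 0 < h) {g : ℍ → ℂ}
    (hg : HasExpansionFrom h g) :
    ∃ C c : ℝ, 0 < c ∧ ∀ τ : ℍ, 1 ≤ τ.im → ‖g τ‖ ≤ C * Real.exp (-(c * τ.im)) := by
  obtain ⟨N, a, hN, hs⟩ := hg
  have hN' : (0 : ℝ) < N := by exact_mod_cast hN
  have hnorm : ∀ (τ : ℍ) (n : ℕ), ‖a n * Complex.exp (2 * Real.pi * Complex.I *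
      (((h : ℂ) + (n : ℂ)) / (N : ℂ)) * (τ : ℂ))‖ =
      ‖a n‖ * Real.exp (-(2 * Real.pi * ((h + n) / N) * τ.im)) := by
    intro τ n
    rw [norm_mul, Complex.norm_exp]
    congr 2
    rw [show 2 * (Real.pi : ℂ) * Complex.I * (((h : ℂ) + (n : ℂ)) / (N : ℂ)) * (τ : ℂ) =
      ((2 * Real.pi * ((h + n) / N) : ℝ) : ℂ) * (Complex.I * τ) by push_cast; ring,
      Complex.re_ofReal_mul]
    simp
  have hI := (hs UpperHalfPlane.I).summable.norm
  simp only [hnorm, UpperHalfPlane.I_im, mul_one] at hI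
  have hh' : (0 : ℝ) < h := by exact_mod_cast hh
  -- Absolute convergence at `τ = i` controls the coefficients. For `Im τ ≥ 1` the leading
  -- exponential decay `e^{-2πh(Im τ - 1)/N}` factors out of every term, because `n (Im τ - 1) ≥ 0`.
  refine ⟨(∑' n : ℕ, ‖a n‖ * Real.exp (-(2 * Real.pi * ((h + n) / N)))) *
    Real.exp (2 * Real.pi * (h / N)), 2 * Real.pi * (h / N), by positivity, fun τ hτ => ?_⟩
  rw [mul_assoc, ← Real.exp_add, ← tsum_mul_right, ← (hs τ).tsum_eq]
  refine tsum_of_norm_bounded (hI.mul_right _).hasSum fun n => ?_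
  rw [hnorm, mul_assoc ‖a n‖, ← Real.exp_add]
  gcongr
  have : 0 ≤ 2 * Real.pi * (n / N) * (τ.im - 1) := by
    have := sub_nonneg.mpr hτ
    positivity
  rw [add_div]
  linarith

theorem tendsto_mul_im_rpow_of_exp_decay {g : ℍ → ℂ} {C c : ℝ} (hc : 0 < c)
    (hg : ∀ τ : ℍ, 1 ≤ τ.im → ‖g τ‖ ≤ C * Real.exp (-(c * τ.im))) (s : ℝ) :
    Tendsto (fun τ => ‖g τ‖ * τ.im ^ s) atImInfty (𝓝 0) := by
  have h1 : Tendsto (fun y : ℝ => C * (y ^ s * Real.exp (-c * y))) atTop (𝓝 0) := by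
    simpa using (tendsto_rpow_mul_exp_neg_mul_atTop_nhds_zero s c hc).const_mul C
  have h2 := h1.comp (tendsto_comap : Tendsto UpperHalfPlane.im atImInfty atTop)
  refine squeeze_zero' (Eventually.of_forall fun τ => ?_) ?_ h2
  · have := τ.im_pos
    positivity
  · have : ∀ᶠ τ : ℍ in atImInfty, 1 ≤ τ.im :=
      tendsto_comap.eventually (eventually_ge_atTop 1)
    filter_upwards [this] with τ hτ
    have h3 := τ.im_pos
    calc _ ≤ C * Real.exp (-(c * τ.im)) * τ.im ^ s := by gcongr; exact hg τ hτ
      _ = _ := by simp only [Function.comp_apply, neg_mul]; ring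

theorem isZeroAtImInfty_of_exp_decay {g : ℍ → ℂ} {C c : ℝ} (hc : 0 < c)
    (hg : ∀ τ : ℍ, 1 ≤ τ.im → ‖g τ‖ ≤ C * Real.exp (-(c * τ.im))) : IsZeroAtImInfty g := by
  have := tendsto_mul_im_rpow_of_exp_decay hc hg 0
  simp only [Real.rpow_zero, mul_one] at this
  exact tendsto_zero_iff_norm_tendsto_zero.mpr this

/-- Vanishing at `∞` kills all coefficients of index `n ≤ 0`, so the `q`-expansion starts at `n =
1`. -/
theorem hasExpansionFrom_one {f : ℍ → ℂ} (hf : MDifferentiable 𝓘(ℂ) 𝓘(ℂ) f) {P : ℕ}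
    (hP : 0 < P) (hper : ∀ τ : ℍ, f ((P : ℝ) +ᵥ τ) = f τ) (h0 : IsZeroAtImInfty f) :
    HasExpansionFrom 1 f := by
  have hP' : (0 : ℝ) < P := by exact_mod_cast hP
  refine ⟨P, fun n => horizontalCoeff f P ((((1 : ℕ) : ℤ) + n : ℤ) / P) 1, hP, fun τ => ?_⟩
  have hy : 0 < τ.im / 2 := half_pos τ.im_pos
  obtain ⟨A, hA⟩ := exists_norm_le_of_im_eq hf.continuous hP' hper hy
  have := (hasSum_and_norm_le_of_horizontalCoeff_eq_zero hf hP' hper 1 (fun n hn => ?_) τ hy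
    (half_lt_self τ.im_pos) hA).1
  · refine this.congr_fun fun n => ?_
    push_cast
    rfl
  · refine horizontalCoeff_eq_zero hf hP' ?_ (fun τ => ?_) h0 one_pos
    · have : (n : ℝ) ≤ 0 := by exact_mod_cast Int.lt_add_one_iff.mp (by simpa using hn)
      exact div_nonpos_of_nonpos_of_nonneg this hP'.le
    · have hPc : (P : ℂ) ≠ 0 := by exact_mod_cast hP.ne'
      rw [show 2 * (Real.pi : ℂ) * Complex.I * ((n / (P : ℝ) : ℝ) : ℂ) * ((P : ℝ) : ℂ) =
        n * (2 * Real.pi * Complex.I) by push_cast; field_simp,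
        Complex.exp_int_mul_two_pi_mul_I, one_mul, hper]

/-! ### The space of cusp forms as a subspace -/

section CuspSubmodule

variable {k : ℝ} {v : SL(2, ℤ) → Circle} {Γ : Subgroup SL(2, ℤ)} {ρ : Γ →* GL (Fin p) ℂ}

/-- The holomorphic `F : ℍ → ℂ^p` with `F|_k γ = ρ(γ)F` that vanish at all cusps. -/
def cuspSubmodule (k : ℝ) (v : SL(2, ℤ) → Circle) (Γ : Subgroup SL(2, ℤ))
    (ρ : Γ →* GL (Fin p) ℂ) : Submodule ℂ (ℍ → Fin p → ℂ) where
  carrier := {F | (∀ i, MDifferentiable 𝓘(ℂ) 𝓘(ℂ) fun τ => F τ i) ∧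
    (∀ (γ : Γ) (τ : ℍ), slash k v F (γ : SL(2, ℤ)) τ =
      (ρ γ : Matrix (Fin p) (Fin p) ℂ) *ᵥ F τ) ∧
    ∀ σ i, IsZeroAtImInfty (slash k v (fun τ => F τ i) σ)}
  zero_mem' := by
    refine ⟨fun i => mdifferentiable_const, fun γ τ => ?_, fun σ i => ?_⟩
    · simp [slash]
    · refine tendsto_const_nhds.congr fun τ => ?_
      simp [slash]
  add_mem' := by
    rintro F G ⟨hF1, hF2, hF3⟩ ⟨hG1, hG2, hG3⟩
    refine ⟨fun i => (hF1 i).add (hG1 i), fun γ τ => ?_, fun σ i => ?_⟩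
    · rw [slash_add, hF2, hG2, Pi.add_apply, Matrix.mulVec_add]
    · refine ((hF3 σ i).add (hG3 σ i)).congr fun τ => ?_
      exact (slash_add k v (fun τ => F τ i) (fun τ => G τ i) σ τ).symm
  smul_mem' := by
    rintro c F ⟨hF1, hF2, hF3⟩
    refine ⟨fun i => (hF1 i).const_smul c, fun γ τ => ?_, fun σ i => ?_⟩
    · rw [slash_smul, hF2, Pi.smul_apply, Matrix.mulVec_smul]
    · refine ((hF3 σ i).smul c).congr fun τ => ?_
      exact (slash_smul k v c (fun τ => F τ i) σ τ).symm

/-- A common period of the functions `F|_k σ` for `F` with `F|_k γ = ρ(γ)F`, `γ ∈ Γ`. -/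
theorem exists_period (hv : IsMultiplierSystem k v) {κ : ℝ}
    (hκ : (v T : ℂ) = Complex.exp (2 * Real.pi * Complex.I * (κ : ℂ)))
    (hΓ : Γ.FiniteIndex) {hneg : (-1 : SL(2, ℤ)) ∈ Γ} (hρn : IsNormalRep κ ρ hneg)
    (σ : SL(2, ℤ)) :
    ∃ P : ℕ, 0 < P ∧ ∀ F : ℍ → Fin p → ℂ,
      (∀ (γ : Γ) (τ : ℍ), slash k v F (γ : SL(2, ℤ)) τ =
        (ρ γ : Matrix (Fin p) (Fin p) ℂ) *ᵥ F τ) →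
      ∀ τ : ℍ, slash k v F σ ((P : ℝ) +ᵥ τ) = slash k v F σ τ := by
  -- Finite index puts a power of `σTσ⁻¹` in `Γ`. Translation by `M` then acts on `F|_k σ` by the
  -- matrix `A` below, which has finite order `N` by normality, so `MN` is a period.
  obtain ⟨M, hM0, -, hM⟩ := Subgroup.exists_pow_mem_of_index_ne_zero hΓ.index_ne_zero
    (σ * T * σ⁻¹)
  rw [conj_pow] at hM
  obtain ⟨N, hN0, hN⟩ := hρn.finite_order σ M hM0 hM
  refine ⟨M * N, Nat.mul_pos hM0 hN0, fun F hF τ => ?_⟩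
  set A : Matrix (Fin p) (Fin p) ℂ := Complex.exp (2 * Real.pi * Complex.I * (κ : ℂ) * (M : ℂ)) •
    (ρ ⟨σ * T ^ M * σ⁻¹, hM⟩ : Matrix (Fin p) (Fin p) ℂ) with hA
  have hstep : ∀ τ : ℍ, slash k v F σ ((M : ℝ) +ᵥ τ) = A *ᵥ slash k v F σ τ := by
    intro τ
    have h1 : slash k v F (σ * T ^ M) τ =
        Complex.exp (-(2 * Real.pi * Complex.I * κ * M)) • slash k v F σ ((M : ℝ) +ᵥ τ) := by
      rw [slash_mul hv, slash_T_pow hv hκ]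
    have h2 : slash k v F (σ * T ^ M) τ =
        (ρ ⟨σ * T ^ M * σ⁻¹, hM⟩ : Matrix (Fin p) (Fin p) ℂ) *ᵥ slash k v F σ τ := by
      have e : σ * T ^ M = (σ * T ^ M * σ⁻¹) * σ := by group
      rw [congrArg (slash k v F) e, slash_mul hv,
        show slash k v F (σ * T ^ M * σ⁻¹) = fun τ =>
          (ρ ⟨σ * T ^ M * σ⁻¹, hM⟩ : Matrix (Fin p) (Fin p) ℂ) *ᵥ F τ from
          funext fun τ => hF ⟨_, hM⟩ τ, slash_mulVec]
    rw [hA, Matrix.smul_mulVec, ← h2, h1, smul_smul, ← Complex.exp_add]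
    simp
  have hiter : ∀ (n : ℕ) (τ : ℍ), slash k v F σ (((M * n : ℕ) : ℝ) +ᵥ τ) =
      (A ^ n) *ᵥ slash k v F σ τ := by
    intro n
    induction n with
    | zero => intro τ; simp
    | succ n ih =>
      intro τ
      rw [pow_succ', ← Matrix.mulVec_mulVec, ← ih τ, ← hstep, vadd_vadd]
      congr 2
      push_cast
      ring
  rw [hiter, hN, Matrix.one_mulVec]

/-- A positive leading exponent forces exponential decay; conversely, periodicity and vanishing at
`∞` give an expansion starting at `1`. The vanishing condition is visibly linear, whereas the
periods `N` in the expansions may differ between forms. -/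
theorem cuspForms_eq_cuspSubmodule (hv : IsMultiplierSystem k v) {κ : ℝ}
    (hκ : (v T : ℂ) = Complex.exp (2 * Real.pi * Complex.I * (κ : ℂ)))
    (hΓ : Γ.FiniteIndex) {hneg : (-1 : SL(2, ℤ)) ∈ Γ} (hρn : IsNormalRep κ ρ hneg) :
    cuspForms k v Γ ρ = (cuspSubmodule k v Γ ρ : Set (ℍ → Fin p → ℂ)) := by
  ext F
  constructor
  · rintro ⟨⟨h1, h2⟩, h3⟩
    refine ⟨fun i => (h1 i).1, h2, fun σ i => ?_⟩
    obtain ⟨h, hh, hexp⟩ := (h3 i).2 σ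
    obtain ⟨C, c, hc, hb⟩ := hexp.exists_norm_le hh
    exact isZeroAtImInfty_of_exp_decay hc hb
  · rintro ⟨h1, h2, h3⟩
    have hexp : ∀ σ i, HasExpansionFrom 1 (slash k v (fun τ => F τ i) σ) := by
      intro σ i
      obtain ⟨P, hP, hper⟩ := exists_period hv hκ hΓ hρn σ
      exact hasExpansionFrom_one (mdifferentiable_slash k v (h1 i) σ) hP
        (fun τ => congrFun (hper F h2 τ) i) (h3 σ i)
    have hs : ∀ i, (fun τ => F τ i) ∈ scalarForms k v := fun i =>
      ⟨h1 i, fun σ => ⟨1, hexp σ i⟩⟩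
    exact ⟨⟨hs, h2⟩, fun i => ⟨hs i, fun σ => ⟨1, one_pos, hexp σ i⟩⟩⟩

/-! ### The Petersson integrand and boundedness of cusp forms -/

/-- The integrand `⟨F, G⟩ (Im τ)^k` of the Petersson inner product. -/
def pairing (k : ℝ) (F G : ℍ → Fin p → ℂ) (τ : ℍ) : ℂ :=
  (star (F τ) ⬝ᵥ G τ) * ((τ.im ^ k : ℝ) : ℂ)

theorem star_mulVec_dotProduct_mulVec {W : Matrix (Fin p) (Fin p) ℂ}
    (hW : W ∈ Matrix.unitaryGroup (Fin p) ℂ) (a b : Fin p → ℂ) :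
    star (W *ᵥ a) ⬝ᵥ (W *ᵥ b) = star a ⬝ᵥ b := by
  rw [Matrix.star_mulVec, Matrix.dotProduct_mulVec, Matrix.vecMul_vecMul,
    ← Matrix.star_eq_conjTranspose, Matrix.mem_unitaryGroup_iff'.mp hW, Matrix.vecMul_one]

/-- The unitary matrix `ρ(γ)⁻¹` preserves the inner product, and `|j|^(-2k) (Im τ)^k = (Im γτ)^k`.
-/
theorem pairing_slashRep (hρu : IsUnitaryRep ρ) (F G : ℍ → Fin p → ℂ) (γ : Γ) (τ : ℍ) :
    pairing k (slashRep k v ρ F γ) (slashRep k v ρ G γ) τ = pairing k F G (γ • τ) := by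
  have hW : ((ρ γ)⁻¹ : GL (Fin p) ℂ).1 ∈ Matrix.unitaryGroup (Fin p) ℂ := by
    rw [← map_inv]
    exact hρu _
  -- Weight `2k` turns the exponent `k/2` of the imaginary part into `k`.
  have hc := norm_jFactor_rpow_mul_im_rpow (2 * k) γ τ
  rw [mul_div_cancel_left₀ k two_ne_zero, show -(2 * k) = -k * 2 by ring,
    Real.rpow_mul (norm_nonneg _), ← norm_slash_factor k v, Real.rpow_two] at hc
  simp only [pairing, slashRep]
  rw [star_mulVec_dotProduct_mulVec hW, slash, slash, star_smul, smul_dotProduct,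
    dotProduct_smul, smul_smul, smul_eq_mul, mul_right_comm, mul_comm, Complex.star_def,
    Complex.conj_mul', ← Complex.ofReal_pow, ← Complex.ofReal_mul, hc]
  rfl

theorem slashRep_eq_self {F : ℍ → Fin p → ℂ} (hF : F ∈ cuspSubmodule k v Γ ρ) (γ : Γ) :
    slashRep k v ρ F γ = F := by
  funext τ
  rw [slashRep, hF.2.1, Matrix.mulVec_mulVec, Units.inv_mul, Matrix.one_mulVec]

theorem continuous_of_mem_cuspSubmodule {F : ℍ → Fin p → ℂ} (hF : F ∈ cuspSubmodule k v Γ ρ) :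
    Continuous F :=
  continuous_pi fun i => (hF.1 i).continuous

theorem continuous_pairing {F G : ℍ → Fin p → ℂ} (hF : Continuous F) (hG : Continuous G) :
    Continuous (pairing k F G) := by
  refine Continuous.mul ?_ ?_
  · exact Continuous.dotProduct (continuous_star.comp hF) hG
  · exact Complex.continuous_ofReal.comp
      (continuous_im.rpow_const fun τ => Or.inl τ.im_ne_zero)

/-- The function `⟨F, F⟩ (Im τ)^k` is continuous, `Γ`-invariant and tends to `0` at every cusp,
hence is bounded because `Γ` has finite index. -/
theorem exists_norm_mul_im_rpow_le (hv : IsMultiplierSystem k v) {κ : ℝ}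
    (hκ : (v T : ℂ) = Complex.exp (2 * Real.pi * Complex.I * (κ : ℂ)))
    (hΓ : Γ.FiniteIndex) {hneg : (-1 : SL(2, ℤ)) ∈ Γ} (hρn : IsNormalRep κ ρ hneg)
    (hρu : IsUnitaryRep ρ) {F : ℍ → Fin p → ℂ} (hF : F ∈ cuspSubmodule k v Γ ρ) :
    ∃ C, ∀ τ : ℍ, ‖F τ‖ * τ.im ^ (k / 2) ≤ C := by
  have hF' : F ∈ cuspForms k v Γ ρ := by
    rw [cuspForms_eq_cuspSubmodule hv hκ hΓ hρn]
    exact hF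
  have hlim : ∀ (σ : SL(2, ℤ)) (i : Fin p),
      Tendsto (fun τ : ℍ => ‖F (σ • τ) i‖ * (σ • τ).im ^ (k / 2)) atImInfty (𝓝 0) := by
    intro σ i
    obtain ⟨h, hh, hexp⟩ := (hF'.2 i).2 σ
    obtain ⟨C, c, hc, hb⟩ := hexp.exists_norm_le hh
    refine (tendsto_mul_im_rpow_of_exp_decay hc hb (k / 2)).congr fun τ => ?_
    exact norm_slash_mul_im_rpow k v (fun τ => F τ i) σ τ
  have hnorm : ∀ τ, pairing k F F τ = ((∑ i, (‖F τ i‖ * τ.im ^ (k / 2)) ^ 2 : ℝ) : ℂ) := by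
    intro τ
    rw [pairing, dotProduct, Finset.sum_mul, Complex.ofReal_sum]
    refine Finset.sum_congr rfl fun i _ => ?_
    rw [Pi.star_apply, Complex.star_def, Complex.conj_mul', mul_pow,
      ← Real.rpow_natCast (τ.im ^ (k / 2)), ← Real.rpow_mul τ.im_pos.le,
      show k / 2 * ((2 : ℕ) : ℝ) = k by push_cast; ring]
    push_cast
    rfl
  have hcF := continuous_of_mem_cuspSubmodule hF
  obtain ⟨C, hC⟩ := ModularGroup.exists_bound_of_subgroup_invariant_of_isBigO
    (continuous_pairing (k := k) hcF hcF) (le_refl (0 : ℝ)) (Γ := Γ) (fun g => by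
      simp only [Real.rpow_zero]
      have h0 : Tendsto (fun τ : ℍ => pairing k F F (g • τ)) atImInfty (𝓝 0) := by
        simp only [hnorm]
        have := (tendsto_finsetSum Finset.univ fun i _ => (hlim g i).pow 2).ofReal
        simpa using this
      exact h0.isBigO_one ℝ) (fun g hg τ => by
      have := pairing_slashRep (k := k) (v := v) hρu F F ⟨g, hg⟩ τ
      rw [slashRep_eq_self hF] at this
      exact this.symm)
  simp only [Real.rpow_zero, mul_one] at hC
  refine ⟨Real.sqrt C, fun τ => ?_⟩
  have hpos : 0 < τ.im ^ (k / 2) := Real.rpow_pos_of_pos τ.im_pos _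
  rw [← le_div_iff₀ hpos]
  refine (pi_norm_le_iff_of_nonneg (by positivity)).mpr fun i => ?_
  rw [le_div_iff₀ hpos]
  refine Real.le_sqrt_of_sq_le (le_trans ?_ (hC τ))
  rw [hnorm, Complex.norm_real, Real.norm_of_nonneg (by positivity)]
  exact Finset.single_le_sum (f := fun i => (‖F τ i‖ * τ.im ^ (k / 2)) ^ 2)
    (fun i _ => by positivity) (Finset.mem_univ i)

end CuspSubmodule

/-! ### Finite dimensionality -/

section FiniteDimension

variable {k : ℝ} {v : SL(2, ℤ) → Circle} {Γ : Subgroup SL(2, ℤ)} {ρ : Γ →* GL (Fin p) ℂ}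

/-- The norm on `Fin p → ℂ` is the sup norm, so unitary matrices are not isometries; entries of
modulus at most `1` cost a factor `p`. -/
theorem norm_mulVec_le_of_mem_unitaryGroup {W : Matrix (Fin p) (Fin p) ℂ}
    (hW : W ∈ Matrix.unitaryGroup (Fin p) ℂ) (a : Fin p → ℂ) : ‖W *ᵥ a‖ ≤ p * ‖a‖ := by
  refine (pi_norm_le_iff_of_nonneg (by positivity)).mpr fun i => ?_
  rw [Matrix.mulVec, dotProduct]
  refine (norm_sum_le _ _).trans ?_
  have : ∀ j ∈ Finset.univ, ‖W i j * a j‖ ≤ ‖a‖ := fun j _ => by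
    rw [norm_mul]
    calc _ ≤ 1 * ‖a‖ := by
          gcongr
          · exact entry_norm_bound_of_unitary hW i j
          · exact norm_le_pi_norm a j
      _ = _ := one_mul _
  simpa using Finset.sum_le_card_nsmul _ _ _ this

theorem exists_eq_mul_out_inv (Γ : Subgroup SL(2, ℤ)) (g : SL(2, ℤ)) :
    ∃ (γ : Γ) (q : SL(2, ℤ) ⧸ Γ), g = γ * q.out⁻¹ := by
  obtain ⟨γ, hγ⟩ := QuotientGroup.mk_out_eq_mul Γ g⁻¹
  refine ⟨γ, QuotientGroup.mk g⁻¹, ?_⟩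
  rw [hγ]
  group

theorem exists_pow_div_one_sub_le {r ε : ℝ} (h1 : r < 1) (hε : 0 < ε) :
    ∃ L : ℕ, r ^ L / (1 - r) ≤ ε := by
  obtain ⟨L, hL⟩ := exists_pow_lt_of_lt_one (mul_pos hε (sub_pos.mpr h1)) h1
  exact ⟨L, (div_le_iff₀ (sub_pos.mpr h1)).mpr hL.le⟩

/-- If sufficiently many Fourier coefficients of a cusp form vanish, then every bound for
`‖F(τ)‖ (Im τ)^(k/2)` can be halved. -/
theorem norm_mul_im_rpow_le_half (hp : 0 < p) (hv : IsMultiplierSystem k v) (hρu : IsUnitaryRep ρ)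
    {F : ℍ → Fin p → ℂ} (hF : F ∈ cuspSubmodule k v Γ ρ) {P L : SL(2, ℤ) ⧸ Γ → ℕ}
    (hP : ∀ q, 0 < P q)
    (hper : ∀ q (τ : ℍ), slash k v F q.out⁻¹ ((P q : ℝ) +ᵥ τ) = slash k v F q.out⁻¹ τ)
    (hL : ∀ q, Real.exp (-(2 * Real.pi * (1 / 4) / P q)) ^ L q /
      (1 - Real.exp (-(2 * Real.pi * (1 / 4) / P q))) ≤ 1 / (2 * p * 2 ^ (k / 2)))
    (h0 : ∀ q (i : Fin p) (n : ℕ), n < L q →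
      horizontalCoeff (slash k v (fun τ => F τ i) q.out⁻¹) (P q) (n / P q) 1 = 0)
    {C : ℝ} (hC : ∀ τ : ℍ, ‖F τ‖ * τ.im ^ (k / 2) ≤ C) (τ : ℍ) :
    ‖F τ‖ * τ.im ^ (k / 2) ≤ C / 2 := by
  have hC0 : 0 ≤ C := le_trans (by have := τ.im_pos; positivity) (hC τ)
  -- Reduction to `Im w ≥ 1/2`: `τ` is the image of such a point `w` under `γ σ` with `γ ∈ Γ` and `σ
  -- = q.out⁻¹` one of finitely many representatives in the application.
  obtain ⟨g, hg⟩ := ModularGroup.exists_one_half_le_im_smul τ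
  obtain ⟨γ, q, hγq⟩ := exists_eq_mul_out_inv Γ g⁻¹
  set w := g • τ with hw
  have hτ : τ = (γ * q.out⁻¹ : SL(2, ℤ)) • w := by rw [← hγq, hw, inv_smul_smul]
  have hPq : (0 : ℝ) < P q := by exact_mod_cast hP q
  have hw0 := w.im_pos
  have hy : 0 < w.im / 2 := half_pos hw0
  have hcomp : ∀ i, ‖slash k v (fun τ => F τ i) q.out⁻¹ w‖ ≤
      C * (w.im / 2) ^ (-(k / 2)) * (1 / (2 * p * 2 ^ (k / 2))) := by
    intro i
    have hA : ∀ τ : ℍ, τ.im = w.im / 2 →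
        ‖slash k v (fun τ => F τ i) q.out⁻¹ τ‖ ≤ C * (w.im / 2) ^ (-(k / 2)) := by
      intro τ hτ
      rw [Real.rpow_neg hy.le, ← div_eq_mul_inv, le_div_iff₀ (by positivity), ← hτ,
        norm_slash_mul_im_rpow]
      refine le_trans ?_ (hC (q.out⁻¹ • τ))
      have := (q.out⁻¹ • τ).im_pos
      gcongr
      exact norm_le_pi_norm _ i
    have hper' : ∀ τ : ℍ, slash k v (fun τ => F τ i) q.out⁻¹ ((P q : ℝ) +ᵥ τ) =
        slash k v (fun τ => F τ i) q.out⁻¹ τ := fun τ => congrFun (hper q τ) i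
    have hmd := mdifferentiable_slash k v (hF.1 i) q.out⁻¹
    have hcoeff : ∀ n : ℤ, n < L q →
        horizontalCoeff (slash k v (fun τ => F τ i) q.out⁻¹) (P q) (n / P q) 1 = 0 := by
      intro n hn
      rcases le_or_gt 0 n with h | h
      · lift n to ℕ using h
        rw [Int.cast_natCast]
        exact h0 q i n (by exact_mod_cast hn)
      · refine horizontalCoeff_eq_zero hmd hPq ?_ (fun τ => ?_) (hF.2.2 _ i) one_pos
        · exact div_nonpos_of_nonpos_of_nonneg (by exact_mod_cast h.le) hPq.le
        · have hPc : (P q : ℂ) ≠ 0 := by exact_mod_cast (hP q).ne'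
          rw [show 2 * (Real.pi : ℂ) * Complex.I * ((n / (P q : ℝ) : ℝ) : ℂ) * ((P q : ℝ) : ℂ) =
            n * (2 * Real.pi * Complex.I) by push_cast; field_simp,
            Complex.exp_int_mul_two_pi_mul_I, one_mul, hper']
    refine (hasSum_and_norm_le_of_horizontalCoeff_eq_zero hmd hPq hper' (L q) hcoeff w hy
      (half_lt_self hw0) hA).2.trans ?_
    refine mul_le_mul_of_nonneg_left (le_trans ?_ (hL q)) (by positivity)
    -- Comparing the height `Im w` with `Im w / 2` leaves a gap of at least `1/4`, which explains
    -- the constant in `hL`.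
    have hr : Real.exp (-(2 * Real.pi * (w.im - w.im / 2) / P q)) ≤
        Real.exp (-(2 * Real.pi * (1 / 4) / P q)) := by
      gcongr
      linarith
    have hr1 : Real.exp (-(2 * Real.pi * (1 / 4) / P q)) < 1 := by
      rw [Real.exp_lt_one_iff, neg_lt_zero]
      positivity
    have := sub_pos.mpr hr1
    gcongr
  have hslash : slash k v F q.out⁻¹ w = fun i => slash k v (fun τ => F τ i) q.out⁻¹ w := rfl
  have hp' : (0 : ℝ) < p := by exact_mod_cast hp
  have hb : ‖slash k v F q.out⁻¹ w‖ ≤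
      C * (w.im / 2) ^ (-(k / 2)) * (1 / (2 * p * 2 ^ (k / 2))) :=
    (pi_norm_le_iff_of_nonneg (by positivity)).mpr hcomp
  have h1 : ‖F τ‖ * τ.im ^ (k / 2) = ‖slash k v F (γ * q.out⁻¹) w‖ * w.im ^ (k / 2) := by
    rw [norm_slash_mul_im_rpow, ← hτ]
  have h2 : slash k v F (γ * q.out⁻¹) w =
      (ρ γ : Matrix (Fin p) (Fin p) ℂ) *ᵥ slash k v F q.out⁻¹ w := by
    rw [slash_mul hv, show slash k v F (γ : SL(2, ℤ)) = fun τ =>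
      (ρ γ : Matrix (Fin p) (Fin p) ℂ) *ᵥ F τ from funext fun τ => hF.2.1 γ τ, slash_mulVec]
  rw [h1, h2]
  calc _ ≤ p * (C * (w.im / 2) ^ (-(k / 2)) * (1 / (2 * p * 2 ^ (k / 2)))) * w.im ^ (k / 2) := by
        gcongr
        exact (norm_mulVec_le_of_mem_unitaryGroup (hρu γ) _).trans (by gcongr)
    -- In `1/(2 p 2^(k/2))` the `p` absorbs the loss from `ρ(γ)`, the power of two absorbs passing
    -- from height `Im w / 2` to `Im w`, and the remaining `2` does the halving.
    _ = C / 2 := by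
      rw [Real.rpow_neg hy.le, Real.div_rpow hw0.le zero_le_two]
      have := Real.rpow_pos_of_pos hw0 (k / 2)
      field_simp

/-- The map to finitely many Fourier coefficients at the coset representatives is injective: on its
kernel the bound `C` improves to `C / 2^n` for every `n`. -/
theorem finiteDimensional_cuspSubmodule (hp : 0 < p) (hv : IsMultiplierSystem k v) {κ : ℝ}
    (hκ : (v T : ℂ) = Complex.exp (2 * Real.pi * Complex.I * (κ : ℂ)))
    (hΓ : Γ.FiniteIndex) {hneg : (-1 : SL(2, ℤ)) ∈ Γ} (hρn : IsNormalRep κ ρ hneg)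
    (hρu : IsUnitaryRep ρ) : FiniteDimensional ℂ (cuspSubmodule k v Γ ρ) := by
  choose P hP hper using fun q : SL(2, ℤ) ⧸ Γ =>
    exists_period hv hκ hΓ hρn q.out⁻¹
  have hp' : (0 : ℝ) < p := by exact_mod_cast hp
  have hPq : ∀ q, (0 : ℝ) < P q := fun q => by exact_mod_cast hP q
  choose L hL using fun q : SL(2, ℤ) ⧸ Γ =>
    exists_pow_div_one_sub_le (r := Real.exp (-(2 * Real.pi * (1 / 4) / P q)))
      (ε := 1 / (2 * p * 2 ^ (k / 2)))
      (by
        rw [Real.exp_lt_one_iff, neg_lt_zero]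
        have := hPq q
        positivity) (by positivity)
  have hcont : ∀ (F : cuspSubmodule k v Γ ρ) (q : SL(2, ℤ) ⧸ Γ) (i : Fin p),
      Continuous (slash k v (fun τ => F.1 τ i) q.out⁻¹) := fun F q i =>
    (mdifferentiable_slash k v (F.2.1 i) q.out⁻¹).continuous
  let φ : cuspSubmodule k v Γ ρ →ₗ[ℂ] ((q : SL(2, ℤ) ⧸ Γ) → Fin p → Fin (L q) → ℂ) :=
    { toFun := fun F q i n =>
        horizontalCoeff (slash k v (fun τ => F.1 τ i) q.out⁻¹) (P q) ((n : ℕ) / P q) 1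
      map_add' := fun F G => by
        funext q i n
        simp only [Pi.add_apply]
        rw [← horizontalCoeff_add (hcont F q i) (hcont G q i) _ _ one_pos]
        congr 1
        funext τ
        exact slash_add k v (fun τ => F.1 τ i) (fun τ => G.1 τ i) _ τ
      map_smul' := fun c F => by
        funext q i n
        simp only [Pi.smul_apply, smul_eq_mul, RingHom.id_apply]
        rw [← horizontalCoeff_const_mul]
        congr 1
        funext τ
        exact slash_smul k v c (fun τ => F.1 τ i) _ τ }
  refine FiniteDimensional.of_injective φ ((injective_iff_map_eq_zero φ).mpr fun F hF => ?_)
  obtain ⟨C, hC⟩ := exists_norm_mul_im_rpow_le hv hκ hΓ hρn hρu F.2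
  have hn : ∀ (n : ℕ) (τ : ℍ), ‖F.1 τ‖ * τ.im ^ (k / 2) ≤ C / 2 ^ n := by
    intro n
    induction n with
    | zero => simpa using hC
    | succ n ih =>
      intro τ
      rw [pow_succ, ← div_div]
      refine norm_mul_im_rpow_le_half hp hv hρu F.2 hP (fun q => hper q F.1 F.2.2.1) hL
        (fun q i n hn => ?_) ih τ
      exact congrFun (congrFun (congrFun hF q) i) ⟨n, hn⟩
  ext1
  funext τ
  have hlim : Tendsto (fun n : ℕ => C / 2 ^ n) atTop (𝓝 0) :=
    tendsto_const_nhds.div_atTop (tendsto_pow_atTop_atTop_of_one_lt one_lt_two)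
  have := ge_of_tendsto' hlim fun n => hn n τ
  have hpos : 0 < τ.im ^ (k / 2) := Real.rpow_pos_of_pos τ.im_pos _
  exact norm_le_zero_iff.mp (nonpos_of_mul_nonpos_left this hpos)

end FiniteDimension

/-! ### Poincaré series -/

section Poincare

variable {k : ℝ} {v : SL(2, ℤ) → Circle} {Γ : Subgroup SL(2, ℤ)} {ρ : Γ →* GL (Fin p) ℂ}

/-- Elements of `Γ` with the same lower row after right multiplication by `σ` lie in the same
right coset of the stabilizer of `∞`. -/
theorem lowerRow_injective (Γ : Subgroup SL(2, ℤ)) (σ : SL(2, ℤ)) :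
    Function.Injective fun q : RightCosets ((cuspStabilizer Γ).subgroupOf Γ) =>
      ((q.out : SL(2, ℤ)) * σ) 1 := by
  intro q q' h
  simp only at h
  rw [← q.out_eq, ← q'.out_eq, Quotient.eq, QuotientGroup.rightRel_apply,
    Subgroup.mem_subgroupOf]
  refine ⟨(q'.out * q.out⁻¹).2, Subgroup.mem_comap.mpr ?_⟩
  have e : ((q'.out * q.out⁻¹ : Γ) : SL(2, ℤ)) =
      ((q'.out : SL(2, ℤ)) * σ) * ((q.out : SL(2, ℤ)) * σ)⁻¹ := by
    push_cast
    group
  rw [MulAction.mem_stabilizer_iff, OnePoint.smul_infty_eq_self_iff, e]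
  set A := (q.out : SL(2, ℤ)) * σ
  set B := (q'.out : SL(2, ℤ)) * σ
  -- If `(c, d)` is the common lower row, this entry is `cd - dc`.
  have h0 : (B * A⁻¹) 1 0 = 0 := by
    rw [Matrix.SpecialLinearGroup.coe_mul, Matrix.SpecialLinearGroup.coe_inv,
      Matrix.adjugate_fin_two, Matrix.mul_apply, Fin.sum_univ_two, ← congrFun h 0, ← congrFun h 1]
    simp
    ring
  rw [Matrix.SpecialLinearGroup.mapGL_coe_matrix, Matrix.SpecialLinearGroup.map_apply_coe,
    RingHom.mapMatrix_apply, Matrix.map_apply, h0, map_zero]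

theorem jFactor_eq_row (γ : SL(2, ℤ)) (τ : ℍ) :
    jFactor γ τ = ((γ 1 0 : ℤ) : ℂ) * (τ : ℂ) + ((γ 1 1 : ℤ) : ℂ) :=
  rfl

theorem norm_jFactor_rpow_le_of_mem_verticalStrip {k : ℝ} (hk : 0 ≤ k) (γ : SL(2, ℤ)) {τ : ℍ}
    {A B : ℝ} (hB : 0 < B) (hτ : τ ∈ verticalStrip A B) :
    ‖jFactor γ τ‖ ^ (-k) ≤ EisensteinSeries.r ⟨⟨A, B⟩, hB⟩ ^ (-k) * ‖γ 1‖ ^ (-k) :=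
  EisensteinSeries.summand_bound_of_mem_verticalStrip hk (γ 1) hB hτ

/-- Distinct cosets have distinct lower rows, so this is a subsum of the lattice sum over `ℤ²`,
which converges for `k > 2`. -/
theorem summable_lowerRow_rpow (hk : 2 < k) (Γ : Subgroup SL(2, ℤ)) (σ : SL(2, ℤ)) (c : ℝ) :
    Summable fun q : RightCosets ((cuspStabilizer Γ).subgroupOf Γ) =>
      c * ‖((q.out : SL(2, ℤ)) * σ) 1‖ ^ (-k) :=
  ((EisensteinSeries.summable_one_div_norm_rpow hk).comp_injective
    (lowerRow_injective Γ σ)).mul_left c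

/-- This makes each term of the Poincaré series tend to `0` as `Im τ → ∞`. If `c ≠ 0` then `|cτ + d|
≥ Im τ`; if `c = 0` then `j = ±1`, the height is unchanged and the exponential decays. -/
theorem norm_jFactor_rpow_mul_exp_le (hk : 0 < k) {a : ℝ} (ha : 0 < a) (γ : SL(2, ℤ)) (τ : ℍ) :
    ‖jFactor γ τ‖ ^ (-k) * Real.exp (-(a * (γ • τ).im)) ≤
      max (τ.im ^ (-k)) (Real.exp (-(a * τ.im))) := by
  have him := τ.im_pos
  by_cases hc : γ 1 0 = 0
  · refine le_trans (le_of_eq ?_) (le_max_right _ _)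
    have hd : |γ 1 1| = 1 := by
      have hdet := γ.det_coe
      rw [Matrix.det_fin_two, hc, mul_zero, sub_zero] at hdet
      exact Int.isUnit_iff_abs_eq.mp (IsUnit.of_mul_eq_one_right _ hdet)
    have hj : ‖jFactor γ τ‖ = 1 := by
      rw [jFactor_eq_row, hc, Int.cast_zero, zero_mul, zero_add, Complex.norm_intCast]
      exact_mod_cast hd
    rw [im_smul_eq_div_norm_jFactor, hj]
    simp
  · refine le_trans ?_ (le_max_left _ _)
    have h1 : τ.im ≤ ‖jFactor γ τ‖ := by
      have h2 : |(jFactor γ τ).im| = |((γ 1 0 : ℤ) : ℝ)| * τ.im := by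
        simp [jFactor_eq_row, abs_mul, abs_of_pos him]
      have h3 : (1 : ℝ) ≤ |((γ 1 0 : ℤ) : ℝ)| := by exact_mod_cast Int.one_le_abs hc
      calc τ.im ≤ |((γ 1 0 : ℤ) : ℝ)| * τ.im := le_mul_of_one_le_left him.le h3
        _ ≤ _ := h2 ▸ Complex.abs_im_le_norm _
    have h4 := (γ • τ).im_pos
    calc _ ≤ ‖jFactor γ τ‖ ^ (-k) * 1 := by
          gcongr
          rw [Real.exp_le_one_iff, neg_nonpos]
          positivity
      _ ≤ _ := by
          rw [mul_one]
          exact Real.rpow_le_rpow_of_nonpos him h1 (by linarith)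

theorem slash_slashRep (hv : IsMultiplierSystem k v) (f : ℍ → Fin p → ℂ) (γ : Γ) (σ : SL(2, ℤ))
    (τ : ℍ) : slash k v (slashRep k v ρ f γ) σ τ =
      ((ρ γ)⁻¹ : GL (Fin p) ℂ).1 *ᵥ slash k v f (γ * σ) τ := by
  rw [slash_mul hv, ← slash_mulVec]
  rfl

theorem norm_slash_slashRep_le (hv : IsMultiplierSystem k v) (hρu : IsUnitaryRep ρ)
    {f : ℍ → Fin p → ℂ} {C a : ℝ} (hf : ∀ τ : ℍ, ‖f τ‖ ≤ C * Real.exp (-(a * τ.im)))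
    (γ : Γ) (σ : SL(2, ℤ)) (τ : ℍ) :
    ‖slash k v (slashRep k v ρ f γ) σ τ‖ ≤ p * C * (‖jFactor (γ * σ) τ‖ ^ (-k) *
      Real.exp (-(a * ((γ * σ : SL(2, ℤ)) • τ).im))) := by
  have hW : ((ρ γ)⁻¹ : GL (Fin p) ℂ).1 ∈ Matrix.unitaryGroup (Fin p) ℂ := by
    rw [← map_inv]
    exact hρu _
  rw [slash_slashRep hv]
  refine (norm_mulVec_le_of_mem_unitaryGroup hW _).trans ?_
  rw [norm_slash]
  calc _ ≤ p * (‖jFactor (γ * σ) τ‖ ^ (-k) *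
        (C * Real.exp (-(a * ((γ * σ : SL(2, ℤ)) • τ).im)))) := by
        gcongr
        exact hf _
    _ = _ := by ring

theorem norm_slash_slashRep_le_of_mem_verticalStrip (hk : 0 ≤ k) (hv : IsMultiplierSystem k v)
    (hρu : IsUnitaryRep ρ) {f : ℍ → Fin p → ℂ} {C a : ℝ} (hC : 0 ≤ C) (ha : 0 < a)
    (hf : ∀ τ : ℍ, ‖f τ‖ ≤ C * Real.exp (-(a * τ.im))) (γ : Γ) (σ : SL(2, ℤ)) {τ : ℍ}
    {A B : ℝ} (hB : 0 < B) (hτ : τ ∈ verticalStrip A B) :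
    ‖slash k v (slashRep k v ρ f γ) σ τ‖ ≤
      p * C * EisensteinSeries.r ⟨⟨A, B⟩, hB⟩ ^ (-k) * ‖((γ : SL(2, ℤ)) * σ) 1‖ ^ (-k) := by
  refine (norm_slash_slashRep_le hv hρu hf γ σ τ).trans ?_
  rw [mul_assoc (p * C : ℝ)]
  refine mul_le_mul_of_nonneg_left ?_ (by positivity)
  refine le_trans ?_ (norm_jFactor_rpow_le_of_mem_verticalStrip hk _ hB hτ)
  refine mul_le_of_le_one_right (by positivity) ?_
  rw [Real.exp_le_one_iff, neg_nonpos]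
  have := ((γ * σ : SL(2, ℤ)) • τ).im_pos
  positivity

theorem mem_verticalStrip_self (τ : ℍ) : τ ∈ verticalStrip |τ.re| τ.im :=
  ⟨le_rfl, le_rfl⟩

theorem summable_norm_slash_slashRep (hk : 2 < k) (hv : IsMultiplierSystem k v)
    (hρu : IsUnitaryRep ρ) {f : ℍ → Fin p → ℂ} {C a : ℝ} (hC : 0 ≤ C) (ha : 0 < a)
    (hf : ∀ τ : ℍ, ‖f τ‖ ≤ C * Real.exp (-(a * τ.im))) (σ : SL(2, ℤ)) (τ : ℍ) :
    Summable fun q : RightCosets ((cuspStabilizer Γ).subgroupOf Γ) =>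
      ‖slash k v (slashRep k v ρ f q.out) σ τ‖ :=
  Summable.of_nonneg_of_le (fun _ => norm_nonneg _) (fun q =>
    norm_slash_slashRep_le_of_mem_verticalStrip (by linarith) hv hρu hC ha hf q.out σ τ.im_pos
      (mem_verticalStrip_self τ)) (summable_lowerRow_rpow hk Γ σ _)

theorem summable_norm_slashRep (hk : 2 < k) (hv : IsMultiplierSystem k v)
    (hρu : IsUnitaryRep ρ) {f : ℍ → Fin p → ℂ} {C a : ℝ} (hC : 0 ≤ C) (ha : 0 < a)
    (hf : ∀ τ : ℍ, ‖f τ‖ ≤ C * Real.exp (-(a * τ.im))) (τ : ℍ) :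
    Summable fun q : RightCosets ((cuspStabilizer Γ).subgroupOf Γ) =>
      ‖slashRep k v ρ f q.out τ‖ := by
  have := summable_norm_slash_slashRep (Γ := Γ) hk hv hρu hC ha hf 1 τ
  simpa only [slash_one hv] using this

theorem hasSum_poincareSeries (hk : 2 < k) (hv : IsMultiplierSystem k v)
    (hρu : IsUnitaryRep ρ) {f : ℍ → Fin p → ℂ} {C a : ℝ} (hC : 0 ≤ C) (ha : 0 < a)
    (hf : ∀ τ : ℍ, ‖f τ‖ ≤ C * Real.exp (-(a * τ.im))) (τ : ℍ) :
    HasSum (fun q : RightCosets ((cuspStabilizer Γ).subgroupOf Γ) => slashRep k v ρ f q.out τ)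
      (poincareSeries k v ρ ((cuspStabilizer Γ).subgroupOf Γ) f τ) :=
  (summable_norm_slashRep hk hv hρu hC ha hf τ).of_norm.hasSum

theorem hasSum_slash_poincareSeries (hk : 2 < k) (hv : IsMultiplierSystem k v)
    (hρu : IsUnitaryRep ρ) {f : ℍ → Fin p → ℂ} {C a : ℝ} (hC : 0 ≤ C) (ha : 0 < a)
    (hf : ∀ τ : ℍ, ‖f τ‖ ≤ C * Real.exp (-(a * τ.im))) (σ : SL(2, ℤ)) (τ : ℍ) :
    HasSum (fun q : RightCosets ((cuspStabilizer Γ).subgroupOf Γ) =>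
        slash k v (slashRep k v ρ f q.out) σ τ)
      (slash k v (poincareSeries k v ρ ((cuspStabilizer Γ).subgroupOf Γ) f) σ τ) :=
  (hasSum_poincareSeries hk hv hρu hC ha hf (σ • τ)).const_smul _

/-- The majorant is uniform on vertical strips, so the Weierstrass M-test applies on an open
neighbourhood of each point. -/
theorem mdifferentiable_poincareSeries (hk : 2 < k) (hv : IsMultiplierSystem k v)
    (hρu : IsUnitaryRep ρ) {f : ℍ → Fin p → ℂ} {C a : ℝ} (hC : 0 ≤ C) (ha : 0 < a)
    (hf : ∀ τ : ℍ, ‖f τ‖ ≤ C * Real.exp (-(a * τ.im)))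
    (hd : ∀ i, MDifferentiable 𝓘(ℂ) 𝓘(ℂ) fun τ => f τ i) (i : Fin p) :
    MDifferentiable 𝓘(ℂ) 𝓘(ℂ) fun τ =>
      poincareSeries k v ρ ((cuspStabilizer Γ).subgroupOf Γ) f τ i := by
  have hterm : ∀ q : RightCosets ((cuspStabilizer Γ).subgroupOf Γ),
      MDifferentiable 𝓘(ℂ) 𝓘(ℂ) fun τ => slashRep k v ρ f q.out τ i := by
    intro q
    have : (fun τ => slashRep k v ρ f q.out τ i) = ∑ j, fun τ =>
        ((ρ q.out)⁻¹ : GL (Fin p) ℂ).1 i j * slash k v (fun τ => f τ j) q.out τ := by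
      funext τ
      rw [Finset.sum_apply]
      rfl
    rw [this]
    refine MDifferentiable.sum fun j _ => ?_
    exact mdifferentiable_const.mul (mdifferentiable_slash k v (hd j) _)
  rw [UpperHalfPlane.mdifferentiable_iff]
  intro z hz
  set A := |z.re| + 1 with hA
  set B := z.im / 2 with hB
  have hB0 : 0 < B := half_pos hz
  let S : Set ℂ := {w | |w.re| < A ∧ B < w.im}
  have hS : IsOpen S := by
    have h1 : IsOpen {w : ℂ | |w.re| < A} := isOpen_lt (by fun_prop) continuous_const
    have h2 : IsOpen {w : ℂ | B < w.im} := isOpen_lt continuous_const (by fun_prop)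
    exact h1.inter h2
  have hzS : z ∈ S := ⟨by simp [hA], half_lt_self hz⟩
  have hSH : S ⊆ {w | 0 < w.im} := fun w hw => hB0.trans hw.2
  have hdiff := Complex.differentiableOn_tsum_of_summable_norm
    (F := fun (q : RightCosets ((cuspStabilizer Γ).subgroupOf Γ)) (w : ℂ) =>
      slashRep k v ρ f q.out (ofComplex w) i) (U := S)
    (summable_lowerRow_rpow hk Γ 1 (p * C * EisensteinSeries.r ⟨⟨A, B⟩, hB0⟩ ^ (-k)))
    (fun q => (UpperHalfPlane.mdifferentiable_iff.mp (hterm q)).mono hSH) hS (fun q w hw => by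
      have hw' : ofComplex w ∈ verticalStrip A B := by
        rw [ofComplex_apply_of_im_pos (hSH hw)]
        exact ⟨hw.1.le, hw.2.le⟩
      have := norm_slash_slashRep_le_of_mem_verticalStrip (k := k) (by linarith) hv hρu hC ha hf
        q.out 1 hB0 hw'
      rw [slash_one hv] at this
      exact (norm_le_pi_norm _ i).trans this)
  refine ((hdiff.congr fun w _ => ?_).differentiableAt (hS.mem_nhds hzS)).differentiableWithinAt
  exact ((Pi.hasSum.mp (hasSum_poincareSeries hk hv hρu hC ha hf (ofComplex w))) i).tsum_eq.symm

/-- The action of `γ ∈ Γ` on `Λ\Γ` by right multiplication. -/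
def rightCosetsMulEquiv (Λ : Subgroup Γ) (γ : Γ) : RightCosets Λ ≃ RightCosets Λ where
  toFun := Quotient.map (· * γ) fun x y h => by
    change QuotientGroup.rightRel Λ _ _
    have h' : QuotientGroup.rightRel Λ x y := h
    rw [QuotientGroup.rightRel_apply] at h' ⊢
    simpa [mul_assoc] using h'
  invFun := Quotient.map (· * γ⁻¹) fun x y h => by
    change QuotientGroup.rightRel Λ _ _
    have h' : QuotientGroup.rightRel Λ x y := h
    rw [QuotientGroup.rightRel_apply] at h' ⊢
    simpa [mul_assoc] using h'
  left_inv q := by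
    induction q using Quotient.inductionOn with
    | h x => simp
  right_inv q := by
    induction q using Quotient.inductionOn with
    | h x => simp

theorem slashRep_rightCosetsMulEquiv (hv : IsMultiplierSystem k v) (Λ : Subgroup Γ)
    {f : ℍ → Fin p → ℂ} (hinv : ∀ l ∈ Λ, slashRep k v ρ f l = f) (γ : Γ) (q : RightCosets Λ) :
    slashRep k v ρ f (rightCosetsMulEquiv Λ γ q).out =
      slashRep k v ρ (slashRep k v ρ f q.out) γ := by
  rw [← slashRep_mul hv]
  refine slashRep_eq_of_rightRel hv ρ Λ f hinv ?_
  have : rightCosetsMulEquiv Λ γ q = Quotient.mk (QuotientGroup.rightRel Λ) (q.out * γ) := by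
    nth_rewrite 1 [← q.out_eq]
    rfl
  rw [this]
  exact Quotient.mk_out _

/-- Right multiplication by `γ` permutes the cosets; the factor `ρ(γ)⁻¹` thereby introduced is
undone by `ρ(γ)`. -/
theorem slash_poincareSeries (hk : 2 < k) (hv : IsMultiplierSystem k v)
    (hρu : IsUnitaryRep ρ) {f : ℍ → Fin p → ℂ} {C a : ℝ} (hC : 0 ≤ C) (ha : 0 < a)
    (hf : ∀ τ : ℍ, ‖f τ‖ ≤ C * Real.exp (-(a * τ.im)))
    (hinv : ∀ l ∈ (cuspStabilizer Γ).subgroupOf Γ, slashRep k v ρ f l = f) (γ : Γ) (τ : ℍ) :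
    slash k v (poincareSeries k v ρ ((cuspStabilizer Γ).subgroupOf Γ) f) γ τ =
      (ρ γ : Matrix (Fin p) (Fin p) ℂ) *ᵥ
        poincareSeries k v ρ ((cuspStabilizer Γ).subgroupOf Γ) f τ := by
  have h1 := hasSum_slash_poincareSeries (Γ := Γ) hk hv hρu hC ha hf γ τ
  have h2 := ((rightCosetsMulEquiv _ γ).hasSum_iff.mpr
    (hasSum_poincareSeries (Γ := Γ) hk hv hρu hC ha hf τ)).map
    (Matrix.mulVecLin (ρ γ : Matrix (Fin p) (Fin p) ℂ))
    (LinearMap.continuous_of_finiteDimensional _)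
  refine h1.unique (h2.congr_fun fun q => ?_)
  simp only [Function.comp_apply, Matrix.mulVecLin_apply]
  rw [slashRep_rightCosetsMulEquiv hv _ hinv]
  change _ = _ *ᵥ (((ρ γ)⁻¹ : GL (Fin p) ℂ).1 *ᵥ slash k v (slashRep k v ρ f q.out) γ τ)
  rw [Matrix.mulVec_mulVec, Units.mul_inv, Matrix.one_mulVec]

theorem isZeroAtImInfty_slash_poincareSeries (hk : 2 < k) (hv : IsMultiplierSystem k v) {κ : ℝ}
    (hκ : (v T : ℂ) = Complex.exp (2 * Real.pi * Complex.I * (κ : ℂ)))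
    (hΓ : Γ.FiniteIndex) {hneg : (-1 : SL(2, ℤ)) ∈ Γ} (hρn : IsNormalRep κ ρ hneg)
    (hρu : IsUnitaryRep ρ) {f : ℍ → Fin p → ℂ} {C a : ℝ} (hC : 0 ≤ C) (ha : 0 < a)
    (hf : ∀ τ : ℍ, ‖f τ‖ ≤ C * Real.exp (-(a * τ.im)))
    (hinv : ∀ l ∈ (cuspStabilizer Γ).subgroupOf Γ, slashRep k v ρ f l = f) (σ : SL(2, ℤ)) :
    IsZeroAtImInfty
      (slash k v (poincareSeries k v ρ ((cuspStabilizer Γ).subgroupOf Γ) f) σ) := by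
  obtain ⟨P, hP, hper⟩ := exists_period hv hκ hΓ hρn σ
  have hP' : (0 : ℝ) < P := by exact_mod_cast hP
  replace hper := hper _ (slash_poincareSeries hk hv hρu hC ha hf hinv)
  have himtop : Tendsto UpperHalfPlane.im atImInfty atTop := tendsto_comap
  -- The majorant is available only for bounded `Re τ`. Dominated convergence is therefore applied
  -- in a strip containing a full period, and periodicity extends the limit to all `τ`.
  have hlim : Tendsto (slash k v (poincareSeries k v ρ ((cuspStabilizer Γ).subgroupOf Γ) f) σ)
      (atImInfty ⊓ 𝓟 {τ | |τ.re| ≤ P}) (𝓝 0) := by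
    have key := tendsto_tsum_of_dominated_convergence
      (f := fun (τ : ℍ) (q : RightCosets ((cuspStabilizer Γ).subgroupOf Γ)) =>
        slash k v (slashRep k v ρ f q.out) σ τ) (g := fun _ => 0)
      (𝓕 := atImInfty ⊓ 𝓟 {τ | |τ.re| ≤ P})
      (summable_lowerRow_rpow hk Γ σ (p * C * EisensteinSeries.r ⟨⟨P, 1⟩, one_pos⟩ ^ (-k)))
      (fun q => ?_) ?_
    · rw [tsum_zero] at key
      refine key.congr fun τ => ?_
      exact (hasSum_slash_poincareSeries hk hv hρu hC ha hf σ τ).tsum_eq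
    · refine Tendsto.mono_left ?_ inf_le_left
      have hb : Tendsto (fun τ : ℍ => p * C * max (τ.im ^ (-k)) (Real.exp (-(a * τ.im))))
          atImInfty (𝓝 0) := by
        have h1 := (tendsto_rpow_neg_atTop (show 0 < k by linarith)).comp himtop
        have h2 := (Real.tendsto_exp_neg_atTop_nhds_zero.comp
          (tendsto_id.const_mul_atTop ha)).comp himtop
        have := (h1.max h2).const_mul (p * C : ℝ)
        simpa using this
      refine squeeze_zero_norm (fun τ => ?_) hb
      refine (norm_slash_slashRep_le hv hρu hf q.out σ τ).trans ?_
      gcongr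
      exact norm_jFactor_rpow_mul_exp_le (by linarith) ha _ τ
    · rw [eventually_inf_principal]
      filter_upwards [himtop.eventually (eventually_ge_atTop 1)] with τ hτ hre q
      exact norm_slash_slashRep_le_of_mem_verticalStrip (by linarith) hv hρu hC ha hf q.out σ
        one_pos ⟨hre, hτ⟩
  rw [isZeroAtImInfty_iff]
  intro ε hε
  have hev := (tendsto_zero_iff_norm_tendsto_zero.mp hlim).eventually (ge_mem_nhds hε)
  rw [eventually_inf_principal] at hev
  obtain ⟨A, hA⟩ := (atImInfty_mem _).mp hev
  refine ⟨A, fun τ hτ => ?_⟩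
  obtain ⟨τ', him, hre, he⟩ := exists_re_mem_Icc_of_periodic hP' hper τ
  rw [← he]
  refine hA τ' (him ▸ hτ) ?_
  rw [Set.mem_ofPred_eq, abs_of_nonneg hre.1]
  exact hre.2

theorem poincareSeries_mem_cuspSubmodule (hk : 2 < k) (hv : IsMultiplierSystem k v) {κ : ℝ}
    (hκ : (v T : ℂ) = Complex.exp (2 * Real.pi * Complex.I * (κ : ℂ)))
    (hΓ : Γ.FiniteIndex) {hneg : (-1 : SL(2, ℤ)) ∈ Γ} (hρn : IsNormalRep κ ρ hneg)
    (hρu : IsUnitaryRep ρ) {f : ℍ → Fin p → ℂ} {C a : ℝ} (hC : 0 ≤ C) (ha : 0 < a)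
    (hf : ∀ τ : ℍ, ‖f τ‖ ≤ C * Real.exp (-(a * τ.im)))
    (hd : ∀ i, MDifferentiable 𝓘(ℂ) 𝓘(ℂ) fun τ => f τ i)
    (hinv : ∀ l ∈ (cuspStabilizer Γ).subgroupOf Γ, slashRep k v ρ f l = f) :
    poincareSeries k v ρ ((cuspStabilizer Γ).subgroupOf Γ) f ∈ cuspSubmodule k v Γ ρ := by
  refine ⟨mdifferentiable_poincareSeries hk hv hρu hC ha hf hd,
    slash_poincareSeries hk hv hρu hC ha hf hinv, fun σ i => ?_⟩
  have := isZeroAtImInfty_slash_poincareSeries hk hv hκ hΓ hρn hρu hC ha hf hinv σ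
  exact tendsto_pi_nhds.mp this i

end Poincare

/-! ### Weight functions on the upper half-plane -/

section Weights

instance : Countable SL(2, ℤ) :=
  (show Function.Injective fun (g : SL(2, ℤ)) (i j : Fin 2) => g i j from fun g g' h => by
    ext i j
    exact congrFun (congrFun h i) j).countable

/-- `(Im τ / |τ|)³`, a positive function whose sum over `SL₂(ℤ)`-orbits converges. -/
def orbitSummand (τ : ℍ) : ℝ :=
  (τ.im / ‖(τ : ℂ)‖) ^ 3

theorem orbitSummand_pos (τ : ℍ) : 0 < orbitSummand τ :=
  pow_pos (div_pos τ.im_pos (norm_pos_iff.mpr τ.ne_zero)) 3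

/-- `Im (γτ) / |γτ| = Im τ / (|aτ + b| |cτ + d|)`: the summand separates into the two rows of `γ`.
-/
theorem orbitSummand_smul (γ : SL(2, ℤ)) (τ : ℍ) :
    orbitSummand (γ • τ) = τ.im ^ 3 *
      (‖((γ 0 0 : ℤ) : ℂ) * (τ : ℂ) + ((γ 0 1 : ℤ) : ℂ)‖ ^ (-3 : ℝ) *
        ‖((γ 1 0 : ℤ) : ℂ) * (τ : ℂ) + ((γ 1 1 : ℤ) : ℂ)‖ ^ (-3 : ℝ)) := by
  have hj : ‖((γ 1 0 : ℤ) : ℂ) * (τ : ℂ) + ((γ 1 1 : ℤ) : ℂ)‖ ≠ 0 :=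
    norm_ne_zero_iff.mpr (jFactor_ne_zero γ τ)
  have hcoe : ((γ • τ : ℍ) : ℂ) = (((γ 0 0 : ℤ) : ℂ) * (τ : ℂ) + ((γ 0 1 : ℤ) : ℂ)) /
      (((γ 1 0 : ℤ) : ℂ) * (τ : ℂ) + ((γ 1 1 : ℤ) : ℂ)) := by
    simpa using UpperHalfPlane.coe_specialLinearGroup_apply γ τ
  rw [orbitSummand, im_smul_eq_div_norm_jFactor, jFactor_eq_row, hcoe, norm_div,
    Real.rpow_neg (norm_nonneg _), Real.rpow_neg (norm_nonneg _)]
  norm_cast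
  rw [← mul_inv, ← mul_pow, ← inv_pow, ← mul_pow]
  congr 1
  norm_cast at hj
  field_simp

/-- A matrix is determined by its pair of rows, so the sum is dominated by a product of two lattice
sums with exponent `3 > 2`. -/
theorem summable_orbitSummand (Γ : Subgroup SL(2, ℤ)) (τ : ℍ) :
    Summable fun γ : Γ => orbitSummand ((γ : SL(2, ℤ)) • τ) := by
  have hs := EisensteinSeries.summable_one_div_norm_rpow (k := 3) (by norm_num)
  have hprod := hs.mul_of_nonneg hs (fun x => by positivity) (fun x => by positivity)
  have hinj : Function.Injective fun γ : Γ =>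
      (((γ : SL(2, ℤ)) 0, (γ : SL(2, ℤ)) 1) : (Fin 2 → ℤ) × (Fin 2 → ℤ)) := by
    intro γ γ' h
    rw [Prod.mk.injEq] at h
    ext i j
    fin_cases i
    · exact congrFun h.1 j
    · exact congrFun h.2 j
  have hsum := (hprod.comp_injective hinj).mul_left
    (τ.im ^ 3 * (EisensteinSeries.r τ ^ (-3 : ℝ) * EisensteinSeries.r τ ^ (-3 : ℝ)))
  refine Summable.of_nonneg_of_le (fun γ => (orbitSummand_pos _).le) (fun γ => ?_) hsum
  rw [orbitSummand_smul]
  have hτ := τ.im_pos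
  have h0 := EisensteinSeries.summand_bound τ (k := 3) (by norm_num) ((γ : SL(2, ℤ)) 0)
  have h1 := EisensteinSeries.summand_bound τ (k := 3) (by norm_num) ((γ : SL(2, ℤ)) 1)
  calc _ ≤ τ.im ^ 3 * ((EisensteinSeries.r τ ^ (-3 : ℝ) * ‖(γ : SL(2, ℤ)) 0‖ ^ (-3 : ℝ)) *
        (EisensteinSeries.r τ ^ (-3 : ℝ) * ‖(γ : SL(2, ℤ)) 1‖ ^ (-3 : ℝ))) := by
        gcongr
        have := EisensteinSeries.r_pos τ
        positivity
    _ = _ := by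
      simp only [Function.comp_apply]
      ring

/-- There is a nonnegative function on `ℍ` whose sum over every `Γ`-orbit is `1`. -/
theorem exists_orbit_weight (Γ : Subgroup SL(2, ℤ)) :
    ∃ w : ℍ → ℝ, Measurable w ∧ (∀ τ, 0 ≤ w τ) ∧
      ∀ τ, HasSum (fun γ : Γ => w (γ • τ)) 1 := by
  set Φ : ℍ → ℝ := fun τ => ∑' γ : Γ, orbitSummand ((γ : SL(2, ℤ)) • τ) with hΦ
  have hpos : ∀ τ, 0 < Φ τ := fun τ =>
    (summable_orbitSummand Γ τ).tsum_pos (fun γ => (orbitSummand_pos _).le) 1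
      (orbitSummand_pos _)
  have hinv : ∀ (γ : Γ) τ, Φ ((γ : SL(2, ℤ)) • τ) = Φ τ := by
    intro γ τ
    rw [hΦ]
    simp only [← mul_smul]
    exact (Equiv.mulRight γ).tsum_eq fun γ' : Γ => orbitSummand ((γ' : SL(2, ℤ)) • τ)
  have hm0 : Measurable orbitSummand := by
    refine Measurable.pow_const (Measurable.div ?_ ?_) 3
    · exact continuous_im.measurable
    · exact measurable_coe.norm
  have hmΦ : Measurable Φ := by
    -- Passing to `ENNReal` makes the countable sum measurable term by term.
    have h : Φ = fun τ =>
        (∑' γ : Γ, ENNReal.ofReal (orbitSummand ((γ : SL(2, ℤ)) • τ))).toReal := by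
      funext τ
      rw [← ENNReal.ofReal_tsum_of_nonneg (fun γ => (orbitSummand_pos _).le)
        (summable_orbitSummand Γ τ), ENNReal.toReal_ofReal (hpos τ).le]
    rw [h]
    refine ENNReal.measurable_toReal.comp (Measurable.tsum fun γ => ?_)
    exact (hm0.comp (measurable_const_smul (γ : SL(2, ℤ)))).ennreal_ofReal
  -- Dividing by the positive, `Γ`-invariant orbit sum normalizes the total to `1`.
  refine ⟨fun τ => orbitSummand τ / Φ τ, hm0.div hmΦ,
    fun τ => div_nonneg (orbitSummand_pos τ).le (hpos τ).le, fun τ => ?_⟩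
  have h := (summable_orbitSummand Γ τ).hasSum.div_const (Φ τ)
  rw [show ∑' γ : Γ, orbitSummand ((γ : SL(2, ℤ)) • τ) = Φ τ from rfl,
    div_self (hpos τ).ne'] at h
  refine h.congr_fun fun γ => ?_
  change orbitSummand ((γ : SL(2, ℤ)) • τ) / Φ ((γ : SL(2, ℤ)) • τ) = _
  rw [hinv]

theorem mem_cuspStabilizer_iff {Γ : Subgroup SL(2, ℤ)} {M : ℕ}
    (hM : cuspStabilizer Γ = Subgroup.closure {T ^ M, -T ^ M}) (g : SL(2, ℤ)) :
    g ∈ cuspStabilizer Γ ↔ ∃ n : ℤ, g = (T ^ M) ^ n ∨ g = -(T ^ M) ^ n := by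
  rw [hM]
  have hT : T ^ M ∈ Subgroup.closure {T ^ M, -T ^ M} := Subgroup.subset_closure (by simp)
  have hN : -T ^ M ∈ Subgroup.closure {T ^ M, -T ^ M} := Subgroup.subset_closure (by simp)
  constructor
  · intro hg
    induction hg using Subgroup.closure_induction with
    | mem x hx =>
      rcases hx with rfl | rfl
      · exact ⟨1, Or.inl (by simp)⟩
      · exact ⟨1, Or.inr (by simp)⟩
    | one => exact ⟨0, Or.inl (by simp)⟩
    | mul x y _ _ hx hy =>
      obtain ⟨n, rfl | rfl⟩ := hx <;> obtain ⟨n', rfl | rfl⟩ := hy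
      · exact ⟨n + n', Or.inl (by rw [_root_.zpow_add])⟩
      · exact ⟨n + n', Or.inr (by rw [_root_.zpow_add, mul_neg])⟩
      · exact ⟨n + n', Or.inr (by rw [_root_.zpow_add, neg_mul])⟩
      · exact ⟨n + n', Or.inl (by rw [_root_.zpow_add, neg_mul_neg])⟩
    | inv x _ hx =>
      obtain ⟨n, rfl | rfl⟩ := hx
      · exact ⟨-n, Or.inl (by rw [_root_.zpow_neg])⟩
      · exact ⟨-n, Or.inr (by rw [_root_.zpow_neg, inv_neg])⟩
  · rintro ⟨n, rfl | rfl⟩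
    · exact Subgroup.zpow_mem _ hT n
    · have : -(T ^ M) ^ n = (-T ^ M) * (T ^ M) ^ (n - 1) := by
        rw [neg_mul, ← _root_.zpow_one_add, add_sub_cancel]
      rw [this]
      exact mul_mem hN (Subgroup.zpow_mem _ hT _)

/-- Half of the characteristic function of the strip `0 ≤ Re τ < M`. -/
def stripWeight (M : ℕ) (τ : ℍ) : ℝ :=
  (Set.Ico (0 : ℝ) M).indicator (fun _ => 1 / 2) τ.re

theorem T_pow_zpow_smul (M : ℕ) (n : ℤ) (τ : ℍ) : (T ^ M) ^ n • τ = (n * M : ℝ) +ᵥ τ := by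
  have := UpperHalfPlane.modular_T_zpow_smul τ (M * n)
  rw [_root_.zpow_mul, zpow_natCast] at this
  rw [this]
  push_cast
  rw [mul_comm]

/-- Exactly two elements of `Γ_∞`, namely `±T^(M n₀)`, move `τ` into the strip, and each contributes
`1/2`. -/
theorem hasSum_stripWeight {Γ : Subgroup SL(2, ℤ)} {M : ℕ} (hM0 : 0 < M)
    (hM : cuspStabilizer Γ = Subgroup.closure {T ^ M, -T ^ M}) (τ : ℍ) :
    HasSum (fun l : (cuspStabilizer Γ).subgroupOf Γ => stripWeight M ((l : Γ) • τ)) 1 := by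
  have hM' : (0 : ℝ) < M := by exact_mod_cast hM0
  set n₀ : ℤ := -⌊τ.re / M⌋ with hn₀
  have hmem : ∀ g : SL(2, ℤ), g ∈ cuspStabilizer Γ → ∃ l : (cuspStabilizer Γ).subgroupOf Γ,
      ((l : Γ) : SL(2, ℤ)) = g := fun g hg => ⟨⟨⟨g, hg.1⟩, Subgroup.mem_subgroupOf.mpr hg⟩, rfl⟩
  obtain ⟨l₁, hl₁⟩ := hmem _ ((mem_cuspStabilizer_iff hM _).mpr ⟨n₀, Or.inl rfl⟩)
  obtain ⟨l₂, hl₂⟩ := hmem _ ((mem_cuspStabilizer_iff hM _).mpr ⟨n₀, Or.inr rfl⟩)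
  have hne : l₁ ≠ l₂ := by
    rintro rfl
    have h := congrArg (fun g : SL(2, ℤ) => g 0 0) (hl₁.symm.trans hl₂)
    have e := ModularGroup.coe_T_zpow (M * n₀)
    rw [_root_.zpow_mul, zpow_natCast] at e
    simp [e] at h
  have hval : ∀ (n : ℤ), stripWeight M ((n * M : ℝ) +ᵥ τ) = if n = n₀ then 1 / 2 else 0 := by
    intro n
    have hiff : (n * M : ℝ) + τ.re ∈ Set.Ico (0 : ℝ) M ↔ n = n₀ := by
      rw [hn₀, eq_comm, neg_eq_iff_eq_neg, Int.floor_eq_iff, le_div_iff₀ hM', div_lt_iff₀ hM',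
        Set.mem_Ico]
      push_cast
      constructor
      · rintro ⟨h1, h2⟩
        constructor <;> linarith
      · rintro ⟨h1, h2⟩
        constructor <;> linarith
    rw [stripWeight, vadd_re, Set.indicator_apply]
    simp only [hiff]
  have hl : ∀ l : (cuspStabilizer Γ).subgroupOf Γ, l ∉ ({l₁, l₂} : Finset _) →
      stripWeight M ((l : Γ) • τ) = 0 := by
    intro l hl
    rw [Finset.mem_insert, Finset.mem_singleton, not_or] at hl
    obtain ⟨n, hn | hn⟩ := (mem_cuspStabilizer_iff hM _).mp (Subgroup.mem_subgroupOf.mp l.2)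
    · change stripWeight M (((l : Γ) : SL(2, ℤ)) • τ) = 0
      rw [hn, T_pow_zpow_smul, hval, if_neg]
      rintro rfl
      exact hl.1 (Subtype.ext (Subtype.ext (hn.trans hl₁.symm)))
    · change stripWeight M (((l : Γ) : SL(2, ℤ)) • τ) = 0
      rw [hn, ModularGroup.SL_neg_smul, T_pow_zpow_smul, hval, if_neg]
      rintro rfl
      exact hl.2 (Subtype.ext (Subtype.ext (hn.trans hl₂.symm)))
  have hs := hasSum_sum_of_ne_finset_zero (L := SummationFilter.unconditional _) hl
  rw [Finset.sum_pair hne] at hs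
  have e₁ : stripWeight M ((l₁ : Γ) • τ) = 1 / 2 := by
    change stripWeight M (((l₁ : Γ) : SL(2, ℤ)) • τ) = _
    rw [hl₁, T_pow_zpow_smul, hval, if_pos rfl]
  have e₂ : stripWeight M ((l₂ : Γ) • τ) = 1 / 2 := by
    change stripWeight M (((l₂ : Γ) : SL(2, ℤ)) • τ) = _
    rw [hl₂, ModularGroup.SL_neg_smul, T_pow_zpow_smul, hval, if_pos rfl]
  rw [e₁, e₂] at hs
  norm_num at hs
  exact hs

end Weights

/-! ### Pairing cusp forms with Poincaré series -/

section Pairing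

variable {k : ℝ} {v : SL(2, ℤ) → Circle} {Γ : Subgroup SL(2, ℤ)} {ρ : Γ →* GL (Fin p) ℂ}

/-- The frequency `(ν + m_j)/M`. -/
def seedFrequency (M : ℕ) (m : Fin p → ℚ) (ν : ℕ) (j : Fin p) : ℝ :=
  ((ν : ℝ) + (m j : ℝ)) / M

theorem seedFrequency_pos {M : ℕ} (hM0 : 0 < M) {m : Fin p → ℚ} (ν : ℕ) {j : Fin p}
    (hm : 0 < m j) : 0 < seedFrequency M m ν j := by
  have : (0 : ℝ) < m j := by exact_mod_cast hm
  have : (0 : ℝ) < M := by exact_mod_cast hM0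
  unfold seedFrequency
  positivity

theorem seed_eq (M : ℕ) (U : Matrix.unitaryGroup (Fin p) ℂ) (m : Fin p → ℚ) (ν : ℕ) (j : Fin p)
    (τ : ℍ) : seed M U m ν j τ =
      Complex.exp (2 * Real.pi * Complex.I * seedFrequency M m ν j * (τ : ℂ)) •
        ((U⁻¹ : Matrix.unitaryGroup (Fin p) ℂ) : Matrix (Fin p) (Fin p) ℂ) *ᵥ Pi.single j 1 := by
  rw [seed, seedFrequency]
  push_cast
  rfl

theorem norm_seed (M : ℕ) (U : Matrix.unitaryGroup (Fin p) ℂ) (m : Fin p → ℚ) (ν : ℕ)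
    (j : Fin p) (τ : ℍ) : ‖seed M U m ν j τ‖ =
      ‖((U⁻¹ : Matrix.unitaryGroup (Fin p) ℂ) : Matrix (Fin p) (Fin p) ℂ) *ᵥ
        (Pi.single j 1 : Fin p → ℂ)‖ *
        Real.exp (-(2 * Real.pi * seedFrequency M m ν j * τ.im)) := by
  rw [seed_eq, norm_smul, mul_comm, Complex.norm_exp]
  congr 2
  rw [show 2 * (Real.pi : ℂ) * Complex.I * seedFrequency M m ν j * (τ : ℂ) =
    ((2 * Real.pi * seedFrequency M m ν j : ℝ) : ℂ) * (Complex.I * τ) by push_cast; ring,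
    Complex.re_ofReal_mul]
  simp

theorem mdifferentiable_seed (M : ℕ) (U : Matrix.unitaryGroup (Fin p) ℂ) (m : Fin p → ℚ) (ν : ℕ)
    (j i : Fin p) : MDifferentiable 𝓘(ℂ) 𝓘(ℂ) fun τ => seed M U m ν j τ i := by
  rw [UpperHalfPlane.mdifferentiable_iff]
  have : DifferentiableOn ℂ (fun z : ℂ =>
      Complex.exp (2 * Real.pi * Complex.I * seedFrequency M m ν j * z) *
        (((U⁻¹ : Matrix.unitaryGroup (Fin p) ℂ) : Matrix (Fin p) (Fin p) ℂ) *ᵥ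
          (Pi.single j 1 : Fin p → ℂ)) i) {z | 0 < z.im} := by fun_prop
  refine this.congr fun z hz => ?_
  rw [Function.comp_apply, seed_eq, ofComplex_apply_of_im_pos hz]
  rfl

theorem norm_pairing_le (k : ℝ) (F G : ℍ → Fin p → ℂ) (τ : ℍ) :
    ‖pairing k F G τ‖ ≤ p * (‖F τ‖ * ‖G τ‖) * τ.im ^ k := by
  have hk := Real.rpow_pos_of_pos τ.im_pos k
  rw [pairing, norm_mul, Complex.norm_real, Real.norm_of_nonneg hk.le, dotProduct]
  gcongr
  refine (norm_sum_le _ _).trans ?_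
  have : ∀ i ∈ Finset.univ, ‖star (F τ) i * G τ i‖ ≤ ‖F τ‖ * ‖G τ‖ := fun i _ => by
    rw [norm_mul, Pi.star_apply, norm_star]
    exact mul_le_mul (norm_le_pi_norm _ i) (norm_le_pi_norm _ i) (norm_nonneg _) (norm_nonneg _)
  simpa using Finset.sum_le_card_nsmul _ _ _ this

/-- Since `conj e(aτ) = e(-aτ) e^{-4πa Im τ}` with `e(z) = e^{2πiz}`, the pairing splits into a
Fourier kernel for `(UF)_j` and a function of `Im τ` alone. -/
theorem pairing_seed (k : ℝ) (M : ℕ) (U : Matrix.unitaryGroup (Fin p) ℂ) (m : Fin p → ℚ)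
    (ν : ℕ) (j : Fin p) (F : ℍ → Fin p → ℂ) (τ : ℍ) :
    pairing k (seed M U m ν j) F τ =
      ((U : Matrix (Fin p) (Fin p) ℂ) *ᵥ F τ) j *
        Complex.exp (-(2 * Real.pi * Complex.I * seedFrequency M m ν j * (τ : ℂ))) *
        ((τ.im ^ k * Real.exp (-(4 * Real.pi * seedFrequency M m ν j * τ.im)) : ℝ) : ℂ) := by
  have h1 : star (((U⁻¹ : Matrix.unitaryGroup (Fin p) ℂ) : Matrix (Fin p) (Fin p) ℂ) *ᵥ
      (Pi.single j 1 : Fin p → ℂ)) ⬝ᵥ F τ = ((U : Matrix (Fin p) (Fin p) ℂ) *ᵥ F τ) j := by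
    rw [Matrix.star_mulVec, ← Matrix.dotProduct_mulVec, Matrix.UnitaryGroup.inv_val,
      Matrix.star_eq_conjTranspose, Matrix.conjTranspose_conjTranspose, ← Pi.single_star,
      star_one, single_one_dotProduct]
  have h2 : star (Complex.exp (2 * Real.pi * Complex.I * seedFrequency M m ν j * (τ : ℂ))) =
      Complex.exp (-(2 * Real.pi * Complex.I * seedFrequency M m ν j * (τ : ℂ))) *
        ((Real.exp (-(4 * Real.pi * seedFrequency M m ν j * τ.im)) : ℝ) : ℂ) := by
    rw [Complex.star_def, ← Complex.exp_conj, Complex.ofReal_exp, ← Complex.exp_add]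
    congr 1
    apply Complex.ext
    · simp
      ring
    · simp
  rw [pairing, seed_eq, star_smul, smul_dotProduct, h1, h2]
  push_cast
  rw [smul_eq_mul]
  ring

section Integral

variable {M : ℕ} {U : Matrix.unitaryGroup (Fin p) ℂ} {m : Fin p → ℚ}

theorem integrableOn_rpow_mul_exp {s b : ℝ} (hs : -1 < s) (hb : 0 < b) :
    IntegrableOn (fun y : ℝ => y ^ s * Real.exp (-(b * y))) (Set.Ioi 0) := by
  have := integrableOn_rpow_mul_exp_neg_mul_rpow hs one_pos hb
  simpa only [Real.rpow_one, neg_mul] using this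

/-- The integrand of the pairing of `F` with the seed, over the half-plane in real coordinates. -/
def stripIntegrand (k : ℝ) (M : ℕ) (f F : ℍ → Fin p → ℂ) (z : ℝ × ℝ) : ℂ :=
  (Set.Ico (0 : ℝ) M).indicator (fun _ => (1 / 2 : ℂ)) z.1 * ((z.2 ^ 2)⁻¹ : ℝ) *
    pairing k f F (ofComplex (z.1 + z.2 * Complex.I))

theorem stripWeight_mul_pairing (k : ℝ) (M : ℕ) (f F : ℍ → Fin p → ℂ) (τ : ℍ) :
    (stripWeight M τ : ℂ) * pairing k f F τ =
      (τ.im ^ 2 : ℝ) • stripIntegrand k M f F (τ.re, τ.im) := by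
  have hτ : (τ.re : ℂ) + τ.im * Complex.I = τ := Complex.re_add_im τ
  have h0 : (τ.im : ℂ) ≠ 0 := by exact_mod_cast τ.im_ne_zero
  rw [stripIntegrand, hτ, ofComplex_apply, stripWeight, Complex.real_smul]
  by_cases h : τ.re ∈ Set.Ico (0 : ℝ) M
  · rw [Set.indicator_of_mem h, Set.indicator_of_mem h]
    push_cast
    field_simp
  · rw [Set.indicator_of_notMem h, Set.indicator_of_notMem h]
    simp

/-- The bound on `‖F‖ y^(k/2)` leaves `y^(k/2 - 2) e^{-2πay}` on a strip of finite width; the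
exponent exceeds `-1` exactly when `k > 2`. -/
theorem integrableOn_stripIntegrand (hk : 2 < k) (hM0 : 0 < M) {ν : ℕ} {j : Fin p}
    (hm : 0 < m j) {F : ℍ → Fin p → ℂ} (hF : Continuous F) {C : ℝ}
    (hC : ∀ τ : ℍ, ‖F τ‖ * τ.im ^ (k / 2) ≤ C) :
    IntegrableOn (stripIntegrand k M (seed M U m ν j) F) (Set.univ ×ˢ Set.Ioi 0) := by
  have ha := seedFrequency_pos hM0 (m := m) ν hm
  set a := seedFrequency M m ν j
  have hseedc : Continuous (seed M U m ν j) :=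
    continuous_pi fun i => (mdifferentiable_seed M U m ν j i).continuous
  set D := ‖((U⁻¹ : Matrix.unitaryGroup (Fin p) ℂ) : Matrix (Fin p) (Fin p) ℂ) *ᵥ
    (Pi.single j 1 : Fin p → ℂ)‖
  have hdom : IntegrableOn (fun z : ℝ × ℝ =>
      (Set.Ico (0 : ℝ) M).indicator (fun _ => (1 : ℝ)) z.1 *
        (p * D * C * (z.2 ^ (k / 2 - 2) * Real.exp (-(2 * Real.pi * a * z.2)))))
      (Set.univ ×ˢ Set.Ioi 0) := by
    rw [IntegrableOn, Measure.volume_eq_prod, ← Measure.prod_restrict, Measure.restrict_univ]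
    refine Integrable.mul_prod
      (f := (Set.Ico (0 : ℝ) M).indicator (fun _ => (1 : ℝ)))
      (g := fun y : ℝ => p * D * C * (y ^ (k / 2 - 2) * Real.exp (-(2 * Real.pi * a * y)))) ?_ ?_
    · rw [integrable_indicator_iff measurableSet_Ico]
      exact integrableOn_const (by simp) (by simp)
    · exact (integrableOn_rpow_mul_exp (by linarith) (by positivity)).const_mul _
  have hS : MeasurableSet ((Set.univ : Set ℝ) ×ˢ Set.Ioi (0 : ℝ)) :=
    MeasurableSet.univ.prod measurableSet_Ioi
  refine Integrable.mono' hdom ?_ ?_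
  · refine AEStronglyMeasurable.mul (AEStronglyMeasurable.mul ?_ ?_) ?_
    · exact ((measurable_const.indicator measurableSet_Ico).comp measurable_fst).aestronglyMeasurable
    · exact (Complex.measurable_ofReal.comp
        ((measurable_snd.pow_const 2).inv)).aestronglyMeasurable
    · refine ContinuousOn.aestronglyMeasurable ?_ hS
      refine (continuous_pairing hseedc hF).comp_continuousOn ?_
      intro z hz
      refine ContinuousAt.continuousWithinAt ?_
      have hpos : 0 < ((z.1 : ℂ) + z.2 * Complex.I).im := by simpa using hz.2
      have h1 := (mdifferentiableAt_ofComplex hpos).continuousAt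
      exact ContinuousAt.comp (g := ofComplex) (f := fun z : ℝ × ℝ => (z.1 : ℂ) + z.2 * Complex.I)
        h1 (by fun_prop)
  · refine (ae_restrict_iff' hS).mpr (ae_of_all _ fun z hz => ?_)
    have hy : 0 < z.2 := hz.2
    rw [stripIntegrand]
    by_cases h : z.1 ∈ Set.Ico (0 : ℝ) M
    · rw [Set.indicator_of_mem h, Set.indicator_of_mem h, one_mul, norm_mul, norm_mul,
        Complex.norm_real, Real.norm_of_nonneg (by positivity)]
      set τ := ofComplex (z.1 + z.2 * Complex.I) with hτ
      have him : τ.im = z.2 := by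
        rw [hτ, ofComplex_apply_of_im_pos (by simpa using hy)]
        simp [← coe_im]
      have h1 := norm_pairing_le k (seed M U m ν j) F τ
      rw [norm_seed, him] at h1
      have h2 := hC τ
      rw [him] at h2
      have hsplit : z.2 ^ k = z.2 ^ (k / 2) * z.2 ^ (k / 2 - 2) * z.2 ^ 2 := by
        rw [← Real.rpow_natCast, ← Real.rpow_add hy, ← Real.rpow_add hy]
        congr 1
        push_cast
        ring
      have h3 : ‖(1 / 2 : ℂ)‖ ≤ 1 := by norm_num
      calc _ ≤ 1 * (z.2 ^ 2)⁻¹ * (p * (D * Real.exp (-(2 * Real.pi * a * z.2)) * ‖F τ‖) *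
            z.2 ^ k) := by gcongr
        _ = p * D * (‖F τ‖ * z.2 ^ (k / 2)) *
            (z.2 ^ (k / 2 - 2) * Real.exp (-(2 * Real.pi * a * z.2))) := by
          rw [hsplit]
          field_simp
        _ ≤ _ := by gcongr
    · rw [Set.indicator_of_notMem h, Set.indicator_of_notMem h]
      simp

/-- By Fubini the inner integral over `x` is `M` times a horizontal coefficient, independent of `y`
by `hconst`; the `1/2` comes from the strip weight. -/
theorem setIntegral_stripIntegrand (hM0 : 0 < M) {ν : ℕ} {j : Fin p}
    {F : ℍ → Fin p → ℂ}
    (hint : IntegrableOn (stripIntegrand k M (seed M U m ν j) F) (Set.univ ×ˢ Set.Ioi 0))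
    (hconst : ∀ y : ℝ, 0 < y →
      horizontalCoeff (fun τ => ((U : Matrix (Fin p) (Fin p) ℂ) *ᵥ F τ) j) M
        (seedFrequency M m ν j) y =
      horizontalCoeff (fun τ => ((U : Matrix (Fin p) (Fin p) ℂ) *ᵥ F τ) j) M
        (seedFrequency M m ν j) 1) :
    ∫ z in Set.univ ×ˢ Set.Ioi 0, stripIntegrand k M (seed M U m ν j) F z =
      (M / 2 : ℂ) * horizontalCoeff (fun τ => ((U : Matrix (Fin p) (Fin p) ℂ) *ᵥ F τ) j) M
        (seedFrequency M m ν j) 1 *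
      ((∫ y in Set.Ioi (0 : ℝ),
        y ^ (k - 2) * Real.exp (-(4 * Real.pi * seedFrequency M m ν j * y)) : ℝ) : ℂ) := by
  set a := seedFrequency M m ν j with ha
  set g : ℍ → ℂ := fun τ => ((U : Matrix (Fin p) (Fin p) ℂ) *ᵥ F τ) j with hg
  have hMc : (M : ℂ) ≠ 0 := by exact_mod_cast hM0.ne'
  rw [IntegrableOn, Measure.volume_eq_prod, ← Measure.prod_restrict, Measure.restrict_univ] at hint
  rw [Measure.volume_eq_prod, ← Measure.prod_restrict, Measure.restrict_univ,
    integral_prod_symm _ hint, ← integral_complex_ofReal, ← integral_const_mul]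
  refine setIntegral_congr_fun measurableSet_Ioi fun y hy => ?_
  have hy' : (0 : ℝ) < y := hy
  have hval : ∀ x : ℝ, stripIntegrand k M (seed M U m ν j) F (x, y) =
      (Set.Ico (0 : ℝ) M).indicator (fun x : ℝ => ((y ^ (k - 2) *
        Real.exp (-(4 * Real.pi * a * y)) : ℝ) : ℂ) / 2 * (g (ofComplex (x + y * Complex.I)) *
        Complex.exp (-(2 * Real.pi * Complex.I * a * (x + y * Complex.I))))) x := by
    intro x
    rw [stripIntegrand]
    by_cases h : x ∈ Set.Ico (0 : ℝ) M
    · rw [Set.indicator_of_mem h, Set.indicator_of_mem h, pairing_seed,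
        ofComplex_apply_of_im_pos (by simpa using hy')]
      have him : (⟨x + y * Complex.I, by simpa using hy'⟩ : ℍ).im = y := by simp [← coe_im]
      have hsplit : y ^ k = y ^ (k - 2) * y ^ 2 := by
        rw [← Real.rpow_natCast, ← Real.rpow_add hy']
        congr 1
        push_cast
        ring
      have hyc : (y : ℂ) ≠ 0 := by exact_mod_cast hy'.ne'
      rw [him, hsplit, ← ha]
      push_cast
      simp only [hg]
      field_simp
    · rw [Set.indicator_of_notMem h, Set.indicator_of_notMem h]
      simp
  simp only [hval]
  rw [integral_indicator measurableSet_Ico, integral_const_mul, integral_Ico_eq_integral_Ioc,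
    ← intervalIntegral.integral_of_le (by positivity), ← hconst y hy', horizontalCoeff,
    Complex.real_smul]
  push_cast
  field_simp

end Integral

end Pairing

/-! ### Cusp forms orthogonal to all Poincaré series -/

section Orthogonality

variable {k : ℝ} {v : SL(2, ℤ) → Circle} {Γ : Subgroup SL(2, ℤ)} {ρ : Γ →* GL (Fin p) ℂ}
  {M : ℕ} {U : Matrix.unitaryGroup (Fin p) ℂ} {m : Fin p → ℚ} {κ : ℝ}

theorem pairing_smul_of_mem_cuspStabilizer (hρu : IsUnitaryRep ρ)
    {f : ℍ → Fin p → ℂ} (hinv : ∀ l ∈ (cuspStabilizer Γ).subgroupOf Γ, slashRep k v ρ f l = f)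
    {F : ℍ → Fin p → ℂ} (hF : F ∈ cuspSubmodule k v Γ ρ) :
    ∀ l ∈ (cuspStabilizer Γ).subgroupOf Γ, ∀ τ, pairing k f F (l • τ) = pairing k f F τ := by
  intro l hl τ
  rw [← pairing_slashRep (v := v) hρu, hinv l hl, slashRep_eq_self hF]

theorem pairing_out_smul (hρu : IsUnitaryRep ρ) {Λ : Subgroup Γ} (f : ℍ → Fin p → ℂ)
    {F : ℍ → Fin p → ℂ} (hF : F ∈ cuspSubmodule k v Γ ρ) (q : RightCosets Λ) (τ : ℍ) :
    pairing k f F (q.out • τ) = pairing k (slashRep k v ρ f q.out) F τ := by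
  rw [← pairing_slashRep (v := v) hρu, slashRep_eq_self hF]

theorem hasSum_pairing {Λ : Subgroup Γ} {f : ℍ → Fin p → ℂ} {τ : ℍ}
    (hs : HasSum (fun q : RightCosets Λ => slashRep k v ρ f q.out τ)
      (poincareSeries k v ρ Λ f τ)) (F : ℍ → Fin p → ℂ) :
    HasSum (fun q : RightCosets Λ => pairing k (slashRep k v ρ f q.out) F τ)
      (pairing k (poincareSeries k v ρ Λ f) F τ) := by
  refine HasSum.mul_right _ ?_
  simp only [dotProduct]
  refine hasSum_sum fun i _ => HasSum.mul_right _ ?_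
  exact (Pi.hasSum.mp hs i).star

/-- Unfolding of the pairing of a cusp form with a Poincaré series. -/
theorem integrable_and_integral_pairing (hk : 2 < k) (hv : IsMultiplierSystem k v)
    (hκ : (v T : ℂ) = Complex.exp (2 * Real.pi * Complex.I * (κ : ℂ)))
    (hΓ : Γ.FiniteIndex) {hneg : (-1 : SL(2, ℤ)) ∈ Γ} (hρn : IsNormalRep κ ρ hneg)
    (hρu : IsUnitaryRep ρ) (hM0 : 0 < M)
    (hM : cuspStabilizer Γ = Subgroup.closure {T ^ M, -T ^ M}) {ν : ℕ} {j : Fin p}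
    (hm : 0 < m j)
    (hinv : ∀ l ∈ (cuspStabilizer Γ).subgroupOf Γ,
      slashRep k v ρ (seed M U m ν j) l = seed M U m ν j)
    {w : ℍ → ℝ} (hwm : Measurable w) (hw0 : ∀ τ, 0 ≤ w τ)
    (hw : ∀ τ, HasSum (fun γ : Γ => w (γ • τ)) 1) {F : ℍ → Fin p → ℂ}
    (hF : F ∈ cuspSubmodule k v Γ ρ) :
    Integrable (fun τ => (w τ : ℂ) * pairing k (classicalPoincare k v Γ ρ M U m ν j) F τ) ∧
    ∫ τ, (w τ : ℂ) * pairing k (classicalPoincare k v Γ ρ M U m ν j) F τ =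
      ∫ z in Set.univ ×ˢ Set.Ioi 0, stripIntegrand k M (seed M U m ν j) F z := by
  have ha := seedFrequency_pos hM0 (m := m) ν hm
  have hbd := fun τ => (norm_seed M U m ν j τ).le
  have ha' : 0 < 2 * Real.pi * seedFrequency M m ν j := by positivity
  obtain ⟨C, hC⟩ := exists_norm_mul_im_rpow_le hv hκ hΓ hρn hρu hF
  have hFc := continuous_of_mem_cuspSubmodule hF
  obtain ⟨hI, hIe⟩ := integrable_and_integral_upperHalfPlane
    (stripWeight_mul_pairing k M (seed M U m ν j) F)
    (integrableOn_stripIntegrand (U := U) hk hM0 hm hFc hC)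
  have hsum := hasSum_poincareSeries (Γ := Γ) (ρ := ρ) hk hv hρu (norm_nonneg _) ha' hbd
  have hΨ : classicalPoincare k v Γ ρ M U m ν j ∈ cuspSubmodule k v Γ ρ :=
    poincareSeries_mem_cuspSubmodule hk hv hκ hΓ hρn hρu (norm_nonneg _) ha' hbd
      (mdifferentiable_seed M U m ν j) hinv
  have hHsum : ∀ τ, HasSum (fun q : RightCosets ((cuspStabilizer Γ).subgroupOf Γ) =>
      pairing k (seed M U m ν j) F (q.out • τ))
      (pairing k (classicalPoincare k v Γ ρ M U m ν j) F τ) := fun τ => by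
    simp only [pairing_out_smul hρu _ hF]
    exact hasSum_pairing (hsum τ) F
  have hns : ∀ τ, Summable fun q : RightCosets ((cuspStabilizer Γ).subgroupOf Γ) =>
      ‖pairing k (seed M U m ν j) F (q.out • τ)‖ := fun τ => (hHsum τ).summable.norm
  have hcont := continuous_pairing (k := k) (continuous_of_mem_cuspSubmodule hΨ) hFc
  have hfun : (fun τ => ∑' q : RightCosets ((cuspStabilizer Γ).subgroupOf Γ),
      pairing k (seed M U m ν j) F (q.out • τ)) =
      pairing k (classicalPoincare k v Γ ρ M U m ν j) F := funext fun τ => (hHsum τ).tsum_eq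
  -- The unfolded function is `⟨f, F⟩ (Im τ)^k` for the seed `f`; its coset sum is the pairing of
  -- the Poincaré series with `F`.
  have key := integrable_and_integral_unfold (μ := (volume : Measure ℍ))
    ((cuspStabilizer Γ).subgroupOf Γ) hwm hw0 hw
    (u := stripWeight M) (fun τ => Set.indicator_nonneg (fun _ _ => by norm_num) _)
    (hasSum_stripWeight hM0 hM) (pairing_smul_of_mem_cuspStabilizer hρu hinv hF) hI hns
    (by rw [hfun]; exact hcont.aestronglyMeasurable)
  simp only [fun τ => (hHsum τ).tsum_eq] at key
  exact ⟨key.1, key.2.trans hIe⟩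

/-- The components of `UF` are multiplied by `e^{2πi m_j}` under `τ ↦ τ + M`. -/
theorem unitary_mulVec_vadd (hv : IsMultiplierSystem k v)
    (hκ : (v T : ℂ) = Complex.exp (2 * Real.pi * Complex.I * (κ : ℂ)))
    (hM : cuspStabilizer Γ = Subgroup.closure {T ^ M, -T ^ M})
    (hU : (ρ ⟨T ^ M, T_pow_mem hM⟩ : Matrix (Fin p) (Fin p) ℂ) =
      Complex.exp (-(2 * Real.pi * Complex.I * (κ : ℂ) * (M : ℂ))) •
        (((U⁻¹ : Matrix.unitaryGroup (Fin p) ℂ) : Matrix (Fin p) (Fin p) ℂ) *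
          Matrix.diagonal (fun j => Complex.exp (2 * Real.pi * Complex.I * (m j : ℂ))) *
          (U : Matrix (Fin p) (Fin p) ℂ)))
    {F : ℍ → Fin p → ℂ} (hF : F ∈ cuspSubmodule k v Γ ρ) (j : Fin p) (τ : ℍ) :
    ((U : Matrix (Fin p) (Fin p) ℂ) *ᵥ F ((M : ℝ) +ᵥ τ)) j =
      Complex.exp (2 * Real.pi * Complex.I * (m j : ℂ)) *
        ((U : Matrix (Fin p) (Fin p) ℂ) *ᵥ F τ) j := by
  have hUU : (U : Matrix (Fin p) (Fin p) ℂ) *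
      ((U⁻¹ : Matrix.unitaryGroup (Fin p) ℂ) : Matrix (Fin p) (Fin p) ℂ) = 1 := by
    rw [← Matrix.UnitaryGroup.mul_val]
    simp
  have h1 := hF.2.1 ⟨T ^ M, T_pow_mem hM⟩ τ
  rw [hU, slash_T_pow hv hκ, Matrix.smul_mulVec] at h1
  have h2 := smul_right_injective (Fin p → ℂ) (Complex.exp_ne_zero _) h1
  rw [h2, Matrix.mulVec_mulVec, ← Matrix.mul_assoc, ← Matrix.mul_assoc, hUU, Matrix.one_mul,
    ← Matrix.mulVec_mulVec, Matrix.mulVec_diagonal]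

theorem mdifferentiable_unitary_mulVec {F : ℍ → Fin p → ℂ}
    (hF : ∀ i, MDifferentiable 𝓘(ℂ) 𝓘(ℂ) fun τ => F τ i) (j : Fin p) :
    MDifferentiable 𝓘(ℂ) 𝓘(ℂ) fun τ => ((U : Matrix (Fin p) (Fin p) ℂ) *ᵥ F τ) j := by
  have : (fun τ => ((U : Matrix (Fin p) (Fin p) ℂ) *ᵥ F τ) j) = ∑ i, fun τ =>
      (U : Matrix (Fin p) (Fin p) ℂ) j i * F τ i := by
    funext τ
    rw [Finset.sum_apply]
    rfl
  rw [this]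
  exact MDifferentiable.sum fun i _ => mdifferentiable_const.mul (hF i)

theorem isZeroAtImInfty_unitary_mulVec (hv : IsMultiplierSystem k v) {F : ℍ → Fin p → ℂ}
    (hF : F ∈ cuspSubmodule k v Γ ρ) (j : Fin p) :
    IsZeroAtImInfty fun τ => ((U : Matrix (Fin p) (Fin p) ℂ) *ᵥ F τ) j := by
  have h : Tendsto F atImInfty (𝓝 0) := tendsto_pi_nhds.mpr fun i => by
    have := hF.2.2 1 i
    rw [slash_one hv] at this
    exact this
  have hc : Continuous fun x : Fin p → ℂ => ((U : Matrix (Fin p) (Fin p) ℂ) *ᵥ x) j :=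
    (continuous_apply j).comp (continuous_const.matrix_mulVec continuous_id)
  have := (hc.tendsto 0).comp h
  rwa [Matrix.mulVec_zero] at this

/-- A holomorphic function with `g(τ + M) = e^{2πi μ} g(τ)`, `0 < μ ≤ 1`, that vanishes at `∞` and
whose Fourier coefficients at the frequencies `(ν + μ)/M`, `ν ≥ 0`, vanish is zero. -/
theorem eq_zero_of_horizontalCoeff_eq_zero (hM0 : 0 < M) {μ : ℝ} (hμ : μ ≤ 1) {g : ℍ → ℂ}
    (hg : MDifferentiable 𝓘(ℂ) 𝓘(ℂ) g) (hg0 : IsZeroAtImInfty g)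
    (hper : ∀ τ : ℍ, g ((M : ℝ) +ᵥ τ) = Complex.exp (2 * Real.pi * Complex.I * μ) * g τ)
    (h0 : ∀ ν : ℕ, horizontalCoeff g M ((ν + μ) / M) 1 = 0) : g = 0 := by
  have hM' : (0 : ℝ) < M := by exact_mod_cast hM0
  have hMc : (M : ℂ) ≠ 0 := by exact_mod_cast hM0.ne'
  have hper' : ∀ (n : ℤ) (τ : ℍ), g ((M : ℝ) +ᵥ τ) = Complex.exp (2 * Real.pi * Complex.I *
      (((n + μ) / M : ℝ) : ℂ) * ((M : ℝ) : ℂ)) * g τ := by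
    intro n τ
    rw [hper, show 2 * Real.pi * Complex.I * (((n + μ) / M : ℝ) : ℂ) * ((M : ℝ) : ℂ) =
      2 * Real.pi * Complex.I * μ + n * (2 * Real.pi * Complex.I) by push_cast; field_simp; ring,
      Complex.exp_add, Complex.exp_int_mul_two_pi_mul_I, mul_one]
  have hall : ∀ (n : ℤ) {y : ℝ}, 0 < y → horizontalCoeff g M ((n + μ) / M) y = 0 := by
    intro n y hy
    rcases le_or_gt 0 n with h | h
    · rw [horizontalCoeff_eq hg _ (hper' n) hy one_pos]
      lift n to ℕ using h
      rw [Int.cast_natCast]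
      exact h0 n
    · refine horizontalCoeff_eq_zero hg hM' ?_ (hper' n) hg0 hy
      -- Here `μ ≤ 1` enters: for `n ≤ -1` the frequency `(n + μ)/M` is not positive.
      have : (n : ℝ) ≤ -1 := by exact_mod_cast Int.le_sub_one_of_lt h
      exact div_nonpos_of_nonpos_of_nonneg (by linarith) hM'.le
  -- The twist by `e^{-2πiμτ/M}` makes the function `M`-periodic and shifts the frequencies `(n +
  -- μ)/M` to `n/M`.
  let f : ℍ → ℂ := fun τ =>
    g τ * Complex.exp (-(2 * Real.pi * Complex.I * (μ / M : ℝ) * (τ : ℂ)))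
  have hfc : Continuous f :=
    hg.continuous.mul (Complex.continuous_exp.comp (continuous_const.mul continuous_coe).neg)
  have hfper : ∀ τ : ℍ, f ((M : ℝ) +ᵥ τ) = f τ := by
    intro τ
    simp only [f]
    rw [hper, mul_comm (Complex.exp _) (g τ), mul_assoc, ← Complex.exp_add, coe_vadd]
    congr 2
    push_cast
    field_simp
    ring
  have hfcoeff : ∀ (n : ℤ) {y : ℝ}, 0 < y → horizontalCoeff f M (n / M) y = 0 := by
    intro n y hy
    rw [← hall n hy, horizontalCoeff, horizontalCoeff]
    congr 1
    refine intervalIntegral.integral_congr fun x _ => ?_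
    simp only [f]
    rw [mul_assoc, ← Complex.exp_add, ofComplex_apply_of_im_pos (by simpa using hy)]
    congr 2
    push_cast
    field_simp
    ring
  funext τ
  have hs := hasSum_horizontalCoeff hfc hM' hfper τ (by
    simp only [hfcoeff _ τ.im_pos, norm_zero, zero_mul]
    exact summable_zero)
  simp only [hfcoeff _ τ.im_pos, zero_mul] at hs
  have := hs.unique hasSum_zero
  exact (mul_eq_zero.mp this).resolve_right (Complex.exp_ne_zero _)

/-- Each integral is a Fourier coefficient of a component of `UF` times `M/2` and a positive Gamma
integral, so its vanishing kills the coefficient. All components of `UF` are then zero, and `U` is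
invertible. -/
theorem eq_zero_of_integral_pairing_eq_zero (hk : 2 < k) (hv : IsMultiplierSystem k v)
    (hκ : (v T : ℂ) = Complex.exp (2 * Real.pi * Complex.I * (κ : ℂ)))
    (hΓ : Γ.FiniteIndex) {hneg : (-1 : SL(2, ℤ)) ∈ Γ} (hρn : IsNormalRep κ ρ hneg)
    (hρu : IsUnitaryRep ρ) (hM0 : 0 < M)
    (hM : cuspStabilizer Γ = Subgroup.closure {T ^ M, -T ^ M})
    (hm : ∀ j, 0 < m j ∧ m j ≤ 1)
    (hU : (ρ ⟨T ^ M, T_pow_mem hM⟩ : Matrix (Fin p) (Fin p) ℂ) =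
      Complex.exp (-(2 * Real.pi * Complex.I * (κ : ℂ) * (M : ℂ))) •
        (((U⁻¹ : Matrix.unitaryGroup (Fin p) ℂ) : Matrix (Fin p) (Fin p) ℂ) *
          Matrix.diagonal (fun j => Complex.exp (2 * Real.pi * Complex.I * (m j : ℂ))) *
          (U : Matrix (Fin p) (Fin p) ℂ)))
    (hinv : ∀ ν j, ∀ l ∈ (cuspStabilizer Γ).subgroupOf Γ,
      slashRep k v ρ (seed M U m ν j) l = seed M U m ν j)
    {w : ℍ → ℝ} (hwm : Measurable w) (hw0 : ∀ τ, 0 ≤ w τ)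
    (hw : ∀ τ, HasSum (fun γ : Γ => w (γ • τ)) 1) {F : ℍ → Fin p → ℂ}
    (hF : F ∈ cuspSubmodule k v Γ ρ)
    (h0 : ∀ ν j, ∫ τ, (w τ : ℂ) * pairing k (classicalPoincare k v Γ ρ M U m ν j) F τ = 0) :
    F = 0 := by
  have hM' : (0 : ℝ) < M := by exact_mod_cast hM0
  have hMc : (M : ℂ) ≠ 0 := by exact_mod_cast hM0.ne'
  obtain ⟨C, hC⟩ := exists_norm_mul_im_rpow_le hv hκ hΓ hρn hρu hF
  have hper : ∀ (j : Fin p) (τ : ℍ), ((U : Matrix (Fin p) (Fin p) ℂ) *ᵥ F ((M : ℝ) +ᵥ τ)) j =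
      Complex.exp (2 * Real.pi * Complex.I * ((m j : ℝ) : ℂ)) *
        ((U : Matrix (Fin p) (Fin p) ℂ) *ᵥ F τ) j := fun j τ => by
    rw [Complex.ofReal_ratCast]
    exact unitary_mulVec_vadd hv hκ hM hU hF j τ
  have hUF : ∀ j, (fun τ => ((U : Matrix (Fin p) (Fin p) ℂ) *ᵥ F τ) j) = 0 := by
    intro j
    have hmd := mdifferentiable_unitary_mulVec (U := U) hF.1 j
    refine eq_zero_of_horizontalCoeff_eq_zero (μ := m j) hM0 (by exact_mod_cast (hm j).2) hmd
      (isZeroAtImInfty_unitary_mulVec hv hF j) (hper j) fun ν => ?_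
    have hint := integrableOn_stripIntegrand (U := U) (ν := ν) hk hM0 (hm j).1
      (continuous_of_mem_cuspSubmodule hF) hC
    have hI := (integrable_and_integral_pairing hk hv hκ hΓ hρn hρu hM0 hM (hm j).1 (hinv ν j)
      hwm hw0 hw hF).2
    rw [h0, setIntegral_stripIntegrand hM0 hint (fun y hy =>
      horizontalCoeff_eq hmd _ (fun τ => ?_) hy one_pos)] at hI
    · have hb : 0 < 4 * Real.pi * seedFrequency M m ν j := by
        have := seedFrequency_pos hM0 (m := m) ν (hm j).1
        positivity
      have hpos : (∫ y in Set.Ioi (0 : ℝ), y ^ (k - 2) *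
          Real.exp (-(4 * Real.pi * seedFrequency M m ν j * y))) ≠ 0 := by
        -- The integral is `Γ(k - 1)/(4πa)^(k - 1)` with `a` the frequency.
        have := Real.integral_rpow_mul_exp_neg_mul_Ioi (a := k - 1) (by linarith) hb
        rw [show k - 1 - 1 = k - 2 by ring] at this
        rw [this]
        have h1 := Real.Gamma_pos_of_pos (show 0 < k - 1 by linarith)
        positivity
      rcases mul_eq_zero.mp hI.symm with h | h
      · exact (mul_eq_zero.mp h).resolve_left (by simpa using hM0.ne')
      · exact absurd (by exact_mod_cast h) hpos
    · rw [hper j τ]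
      congr 1
      rw [seedFrequency, show 2 * Real.pi * Complex.I * ((((ν : ℝ) + (m j : ℝ)) / M : ℝ) : ℂ) *
        ((M : ℝ) : ℂ) = 2 * Real.pi * Complex.I * ((m j : ℝ) : ℂ) +
          (ν : ℤ) * (2 * Real.pi * Complex.I) by push_cast; field_simp; ring,
        Complex.exp_add, Complex.exp_int_mul_two_pi_mul_I, mul_one]
  funext τ
  have h : (U : Matrix (Fin p) (Fin p) ℂ) *ᵥ F τ = 0 := funext fun j => congrFun (hUF j) τ
  have hUU : ((U⁻¹ : Matrix.unitaryGroup (Fin p) ℂ) : Matrix (Fin p) (Fin p) ℂ) *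
      (U : Matrix (Fin p) (Fin p) ℂ) = 1 := by
    rw [← Matrix.UnitaryGroup.mul_val]
    simp
  rw [← Matrix.one_mulVec (F τ), ← hUU, ← Matrix.mulVec_mulVec, h, Matrix.mulVec_zero]
  rfl

/-! ### Sesquilinearity of the pairing and the span criterion -/

theorem pairing_add_left (F G H : ℍ → Fin p → ℂ) (τ : ℍ) :
    pairing k (F + G) H τ = pairing k F H τ + pairing k G H τ := by
  simp [pairing, add_dotProduct, add_mul]

theorem pairing_smul_left (c : ℂ) (F H : ℍ → Fin p → ℂ) (τ : ℍ) :
    pairing k (c • F) H τ = star c * pairing k F H τ := by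
  simp [pairing, mul_assoc]

theorem pairing_add_right (F G H : ℍ → Fin p → ℂ) (τ : ℍ) :
    pairing k F (G + H) τ = pairing k F G τ + pairing k F H τ := by
  simp [pairing, dotProduct_add, add_mul]

theorem pairing_smul_right (c : ℂ) (F H : ℍ → Fin p → ℂ) (τ : ℍ) :
    pairing k F (c • H) τ = c * pairing k F H τ := by
  simp [pairing, mul_assoc]

/-- A subspace of a finite-dimensional space of functions is everything if it has trivial
orthogonal complement for the weighted pairing. -/
theorem span_eq_of_integral_pairing {V : Submodule ℂ (ℍ → Fin p → ℂ)} [FiniteDimensional ℂ V]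
    {S : Set (ℍ → Fin p → ℂ)} (hS : S ⊆ V) (w : ℍ → ℝ)
    (hint : ∀ G ∈ S, ∀ F ∈ V, Integrable fun τ => (w τ : ℂ) * pairing k G F τ)
    (h0 : ∀ F ∈ V, (∀ G ∈ S, ∫ τ, (w τ : ℂ) * pairing k G F τ = 0) → F = 0) :
    Submodule.span ℂ S = V := by
  have hle : Submodule.span ℂ S ≤ V := Submodule.span_le.mpr hS
  have hfd : FiniteDimensional ℂ (Submodule.span ℂ S) := Submodule.finiteDimensional_of_le hle
  have hint' : ∀ G ∈ Submodule.span ℂ S, ∀ F ∈ V,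
      Integrable fun τ => (w τ : ℂ) * pairing k G F τ := by
    intro G hG F hF
    induction hG using Submodule.span_induction with
    | mem G hG => exact hint G hG F hF
    | zero => simp [pairing]
    | add G G' _ _ h h' =>
      simp only [pairing_add_left, mul_add]
      exact h.add h'
    | smul c G _ h =>
      simp only [pairing_smul_left, mul_left_comm _ (star c)]
      exact h.const_mul _
  let b := Module.finBasis ℂ (Submodule.span ℂ S)
  -- Pairing with a basis of the span is linear in `F`. Its injectivity gives `dim V ≤ dim span S`,
  -- so neither positivity of the pairing nor an orthogonal projection is needed.
  let φ : V →ₗ[ℂ] (Fin (Module.finrank ℂ (Submodule.span ℂ S)) → ℂ) :=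
    { toFun := fun F i => ∫ τ, (w τ : ℂ) * pairing k (b i).1 F.1 τ
      map_add' := fun F F' => by
        funext i
        simp only [Submodule.coe_add, pairing_add_right, mul_add, Pi.add_apply]
        exact integral_add (hint' _ (b i).2 _ F.2) (hint' _ (b i).2 _ F'.2)
      map_smul' := fun c F => by
        funext i
        simp only [Submodule.coe_smul, pairing_smul_right, mul_left_comm _ c, Pi.smul_apply,
          RingHom.id_apply, smul_eq_mul]
        exact integral_const_mul _ _ }
  have hφ : Function.Injective φ := by
    refine (injective_iff_map_eq_zero φ).mpr fun F hF => Subtype.ext (h0 F.1 F.2 fun G hG => ?_)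
    -- The elements orthogonal to `F` form a subspace; it contains the basis, hence all of the span
    -- and in particular `S`.
    have hspan : (⊤ : Submodule ℂ (Submodule.span ℂ S)) ≤
        { carrier := {G | ∫ τ, (w τ : ℂ) * pairing k G.1 F.1 τ = 0}
          zero_mem' := by simp [pairing]
          add_mem' := fun {G G'} (h : ∫ τ, (w τ : ℂ) * pairing k G.1 F.1 τ = 0)
              (h' : ∫ τ, (w τ : ℂ) * pairing k G'.1 F.1 τ = 0) => by
            change ∫ τ, (w τ : ℂ) * pairing k (G.1 + G'.1) F.1 τ = 0
            simp only [pairing_add_left, mul_add]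
            rw [integral_add (hint' _ G.2 _ F.2) (hint' _ G'.2 _ F.2), h, h', add_zero]
          smul_mem' := fun c {G} (h : ∫ τ, (w τ : ℂ) * pairing k G.1 F.1 τ = 0) => by
            change ∫ τ, (w τ : ℂ) * pairing k (c • G.1) F.1 τ = 0
            simp only [pairing_smul_left, mul_left_comm _ (star c)]
            rw [integral_const_mul, h, mul_zero] } := by
      rw [← b.span_eq, Submodule.span_le]
      rintro _ ⟨i, rfl⟩
      exact congrFun hF i
    exact hspan (x := ⟨G, Submodule.subset_span hG⟩) trivial
  refine Submodule.eq_of_le_of_finrank_le hle ?_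
  simpa using LinearMap.finrank_le_finrank_of_injective hφ

end Orthogonality

end VVMF

end

/-! ### The spanning theorem -/

theorem corollary5p3 {p : ℕ} (hp : 0 < p) (k : ℝ) (hk : 2 < k)
    (v : SL(2, ℤ) → Circle) (hv : VVMF.IsMultiplierSystem k v)
    (hv_neg : (v (-1) : ℂ) = (-1 : ℂ) ^ (-(k : ℂ)))
    (κ : ℝ) (hκ0 : 0 ≤ κ) (hκ1 : κ < 1)
    (hκ : (v ModularGroup.T : ℂ) = Complex.exp (2 * Real.pi * Complex.I * (κ : ℂ)))
    (Γ : Subgroup SL(2, ℤ)) (hΓ : Γ.FiniteIndex) (hneg : (-1 : SL(2, ℤ)) ∈ Γ)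
    (ρ : Γ →* GL (Fin p) ℂ) (hρu : VVMF.IsUnitaryRep ρ) (hρn : VVMF.IsNormalRep κ ρ hneg)
    (M : ℕ) (hM0 : 0 < M)
    (hM : VVMF.cuspStabilizer Γ =
      Subgroup.closure {ModularGroup.T ^ M, -ModularGroup.T ^ M})
    (U : Matrix.unitaryGroup (Fin p) ℂ) (m : Fin p → ℚ) (hm : ∀ j, 0 < m j ∧ m j ≤ 1)
    (hU : (ρ ⟨ModularGroup.T ^ M, VVMF.T_pow_mem hM⟩ : Matrix (Fin p) (Fin p) ℂ) =
      Complex.exp (-(2 * Real.pi * Complex.I * (κ : ℂ) * (M : ℂ))) •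
        (((U⁻¹ : Matrix.unitaryGroup (Fin p) ℂ) : Matrix (Fin p) (Fin p) ℂ) *
          Matrix.diagonal (fun j => Complex.exp (2 * Real.pi * Complex.I * (m j : ℂ))) *
          (U : Matrix (Fin p) (Fin p) ℂ))) :
    (∀ (ν : ℕ) (j : Fin p) (τ : ℍ),
      Summable fun q : VVMF.RightCosets ((VVMF.cuspStabilizer Γ).subgroupOf Γ) =>
        ‖VVMF.slashRep k v ρ (VVMF.seed M U m ν j) q.out τ‖) ∧
    VVMF.cuspForms k v Γ ρ =
      (Submodule.span ℂ
        {F | ∃ (ν : ℕ) (j : Fin p), F = VVMF.classicalPoincare k v Γ ρ M U m ν j} :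
        Set (ℍ → Fin p → ℂ)) := by

  have hinv := VVMF.seed_invariant hv hv_neg hκ hρn hM0 hM hU
  have ha : ∀ (ν : ℕ) (j : Fin p), 0 < 2 * Real.pi * VVMF.seedFrequency M m ν j := fun ν j => by
    have := VVMF.seedFrequency_pos hM0 ν (hm j).1
    positivity
  refine ⟨fun ν j τ => VVMF.summable_norm_slashRep hk hv hρu (norm_nonneg _) (ha ν j)
    (fun τ => (VVMF.norm_seed M U m ν j τ).le) τ, ?_⟩
  rw [VVMF.cuspForms_eq_cuspSubmodule hv hκ hΓ hρn]
  have := VVMF.finiteDimensional_cuspSubmodule hp hv hκ hΓ hρn hρu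
  obtain ⟨w, hwm, hw0, hw⟩ := VVMF.exists_orbit_weight Γ
  -- The span criterion needs three facts: the Poincaré series are cusp forms, their pairings with
  -- cusp forms are integrable against `w`, and only `0` is orthogonal to all of them.
  refine congrArg _ (VVMF.span_eq_of_integral_pairing (k := k) ?_ w ?_ ?_).symm
  · rintro _ ⟨ν, j, rfl⟩
    exact VVMF.poincareSeries_mem_cuspSubmodule hk hv hκ hΓ hρn hρu (norm_nonneg _) (ha ν j)
      (fun τ => (VVMF.norm_seed M U m ν j τ).le) (VVMF.mdifferentiable_seed M U m ν j) (hinv ν j)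
  · rintro _ ⟨ν, j, rfl⟩ F hF
    exact (VVMF.integrable_and_integral_pairing hk hv hκ hΓ hρn hρu hM0 hM (hm j).1 (hinv ν j)
      hwm hw0 hw hF).1
  · intro F hF h0
    exact VVMF.eq_zero_of_integral_pairing_eq_zero hk hv hκ hΓ hρn hρu hM0 hM hm hU hinv hwm hw0
      hw hF fun ν j => h0 _ ⟨ν, j, rfl⟩
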